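/- Let $R$ be a commutative ring (for instance $\mathbb Z$ or $\mathbb Q$) and let $\mathrm{QSym}$ be the $R$-algebra of quasisymmetric functions in $x_1,x_2,\dots$ A composition $\alpha=(\alpha_1,\dots,\alpha_k)$ is a finite, possibly empty, sequence of positive integers, with weight $|\alpha|=\sum_i\alpha_i$ and rank $r(\alpha)=\alpha_1+\alpha_3+\alpha_5+\cdots$. Let $\mathbf x^\alpha=\sum_{i_1<\cdots<i_k}x_{i_1}^{\alpha_1}\cdots x_{i_k}^{\alpha_k}$, and let $L_\alpha$ be the sum of $\mathbf x^\beta$ over all refinements $\beta$ of $\alpha$. A labeled poset $P$ is a partial order on a finite set of positive integers; $\mathcal L(P)$ is the set of its linear extensions, written as sequences $\pi$, and $F(P)=\sum_{\pi\in\mathcal L(P)}L_{C(\pi)}$, where $C(\pi)$ lists the lengths of the successive maximal increasing runs of $\pi$. Let $P_\alpha=A_1\oplus\cdots\oplus A_k$ be the ordinal sum of antichains with $|A_i|=\alpha_i$, labeled by $1,\dots,|\alpha|$ so that $A_2,A_4,\dots$ are numbered first, in this order, followed by $A_1,A_3,\dots$. Put $N_\alpha=F(P_\alpha)$ (so $N_\alpha=1$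 for the empty composition). For compositions $\alpha,\beta$ write $P_\alpha=A_1\oplus A_2\oplus\cdots$ and $P_\beta=B_1\oplus B_2\oplus\cdots$, and let $Q$ be the disjoint sum of these posets, relabeled by $1,\dots,|\alpha|+|\beta|$ so that $A_2,A_4,\dots,B_2,B_4,\dots$ are numbered first, in this order, followed by $A_1,A_3,\dots,B_1,B_3,\dots$. Let $T_1$ be the union of all $A_i,B_i$ with $i$ odd and $T_2$ the union of those with $i$ even. Cutting $\pi\in\mathcal L(Q)$ into its maximal segments of consecutive entries contained in $T_1$ or in $T_2$, and taking the set of entries of each segment, gives an ordered partition $K_T(\pi)$ of the set of labels. Let $\mathbb K_{\alpha,\beta}=\{K_T(\pi):\pi\in\mathcal L(Q)\}$. Then: 1. $\mathrm{QSym}$ is a graded $R$-algebra with $r$-th graded piece $V_r=\mathrm{span}_R\{N_\alpha: r(\alpha)=r\}$, $r\ge 0$; that is, $\mathrm{QSym}=\bigoplus_{r\ge0}V_r$, $1\in V_0$ and $V_rV_s\subseteq V_{r+s}$. 2. The $N_\alpha$ form an $R$-basis of $\mathrm{QSym}$, and in the expansion $N_\alpha N_\beta=\sum_\nu c^\nu_{\alpha,\beta}N_\nu$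 every $c^\nu_{\alpha,\beta}$ is (the image in $R$ of) a nonnegative integer, namely the number of $K=(K_1,\dots,K_l)\in\mathbb K_{\alpha,\beta}$ of type $(|K_1|,\dots,|K_l|)=\nu$. 3. Every $K=(K_1,\dots,K_l)\in\mathbb K_{\alpha,\beta}$ is alternating: for $1\le i<l$, $x\in K_i$ and $y\in K_{i+1}$ we have $x>y$ if $i$ is odd and $x<y$ if $i$ is even. 4. If some $K\in\mathbb K_{\alpha,\beta}$ has type $\nu$, then $r(\nu)=r(\alpha)+r(\beta)$. -/

import Mathlib

/-! ### Quasisymmetric functions -/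

namespace QSymN

/-- The exponent of the monomial `x_{i 0} ^ a 0 * x_{i 1} ^ a 1 * ⋯`, for an increasing sequence
of indices `i`. -/
noncomputable def expo {k : ℕ} (a : Fin k → ℕ) (i : Fin k ↪o ℕ) : ℕ →₀ ℕ :=
  ∑ t, Finsupp.single (i t) (a t)

theorem expo_apply {k : ℕ} (a : Fin k → ℕ) (i : Fin k ↪o ℕ) (t : Fin k) :
    expo a i (i t) = a t := by
  classical
  simp [expo, Finsupp.finsetSum_apply, Finsupp.single_apply]

theorem expo_apply_of_notMem {k : ℕ} (a : Fin k → ℕ) (i : Fin k ↪o ℕ) {n : ℕ}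
    (hn : n ∉ Set.range i) : expo a i n = 0 := by
  classical
  simp only [expo, Finsupp.finsetSum_apply, Finsupp.single_apply]
  exact Finset.sum_eq_zero fun t _ => if_neg fun h => hn ⟨t, h⟩

theorem expo_add {k : ℕ} (a b : Fin k → ℕ) (i : Fin k ↪o ℕ) :
    expo (a + b) i = expo a i + expo b i := by
  simp [expo, Finset.sum_add_distrib]

theorem eq_expo_of_le {k : ℕ} {a : Fin k → ℕ} {i : Fin k ↪o ℕ} {u : ℕ →₀ ℕ}
    (h : u ≤ expo a i) : u = expo (fun t => u (i t)) i := by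
  ext n
  by_cases hn : n ∈ Set.range i
  · obtain ⟨t, rfl⟩ := hn
    rw [expo_apply]
  · rw [expo_apply_of_notMem _ _ hn]
    have := h n
    rw [expo_apply_of_notMem _ _ hn] at this
    omega

theorem expo_support {k : ℕ} {a : Fin k → ℕ} (ha : ∀ t, 0 < a t) (i : Fin k ↪o ℕ) :
    (expo a i).support = Finset.univ.map i.toEmbedding := by
  ext n
  rw [Finsupp.mem_support_iff, Finset.mem_map]
  constructor
  · intro h
    by_contra hn
    exact h (expo_apply_of_notMem _ _ fun ⟨t, ht⟩ => hn ⟨t, Finset.mem_univ _, ht⟩)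
  · rintro ⟨t, -, rfl⟩
    exact (expo_apply a i t).trans_ne (ha t).ne'

theorem expo_inj {k l : ℕ} {a : Fin k → ℕ} {b : Fin l → ℕ} (ha : ∀ t, 0 < a t)
    (hb : ∀ t, 0 < b t) {i : Fin k ↪o ℕ} {j : Fin l ↪o ℕ} (h : expo a i = expo b j) :
    ∃ e : k = l, ∀ t, a t = b (Fin.cast e t) := by
  have hs := congrArg Finsupp.support h
  rw [expo_support ha, expo_support hb] at hs
  have e : k = l := by simpa using congrArg Finset.card hs
  subst e
  have hij : i = j := by
    refine OrderEmbedding.range_inj.1 ?_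
    have := congrArg (fun s : Finset ℕ => (s : Set ℕ)) hs
    simpa using this
  subst hij
  refine ⟨rfl, fun t => ?_⟩
  have := DFunLike.congr_fun h (i t)
  rwa [expo_apply, expo_apply] at this

variable {R : Type*} [CommRing R]

/-- A power series in the linearly ordered variables `x_0, x_1, …` is quasisymmetric if it has
bounded degree, and for all positive exponents `a_1, …, a_k` and all `i_1 < ⋯ < i_k`,
`j_1 < ⋯ < j_k` the coefficients of `x_{i_1}^{a_1} ⋯ x_{i_k}^{a_k}` and
`x_{j_1}^{a_1} ⋯ x_{j_k}^{a_k}` agree. -/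
def IsQuasisymmetric (f : MvPowerSeries ℕ R) : Prop :=
  (∃ d : ℕ, ∀ m : ℕ →₀ ℕ, d < m.degree → MvPowerSeries.coeff m f = 0) ∧
  ∀ (k : ℕ) (a : Fin k → ℕ), (∀ t, 0 < a t) → ∀ i j : Fin k ↪o ℕ,
    MvPowerSeries.coeff (expo a i) f = MvPowerSeries.coeff (expo a j) f

theorem IsQuasisymmetric.coeff_eq {f : MvPowerSeries ℕ R} (hf : IsQuasisymmetric f) {k : ℕ}
    (a : Fin k → ℕ) (i j : Fin k ↪o ℕ) :
    MvPowerSeries.coeff (expo a i) f = MvPowerSeries.coeff (expo a j) f := by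
  classical
  set s : Finset (Fin k) := Finset.univ.filter (fun t => 0 < a t) with hs
  let e : Fin s.card ↪o Fin k := s.orderEmbOfFin rfl
  have key : ∀ i : Fin k ↪o ℕ, expo a i = expo (fun t => a (e t)) (e.trans i) := by
    intro i
    have h1 : expo a i = ∑ t ∈ s, Finsupp.single (i t) (a t) := by
      unfold expo
      rw [hs, Finset.sum_filter]
      refine Finset.sum_congr rfl fun t _ => ?_
      split_ifs with h
      · rfl
      · simp [Nat.eq_zero_of_not_pos h]
    have h2 : s = Finset.univ.map e.toEmbedding := by
      ext t
      simp only [Finset.mem_map, Finset.mem_univ, true_and]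
      have := s.range_orderEmbOfFin rfl
      exact (Set.ext_iff.1 this t).symm
    have h3 := congrArg (fun u : Finset (Fin k) => ∑ t ∈ u, Finsupp.single (i t) (a t)) h2
    rw [h1, expo]
    exact h3.trans (Finset.sum_map _ _ _)
  rw [key i, key j]
  refine hf.2 _ _ (fun t => ?_) _ _
  have := s.orderEmbOfFin_mem rfl t
  exact (Finset.mem_filter.1 this).2

theorem IsQuasisymmetric.mul {f g : MvPowerSeries ℕ R} (hf : IsQuasisymmetric f)
    (hg : IsQuasisymmetric g) : IsQuasisymmetric (f * g) := by
  classical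
  refine ⟨?_, fun k a _ i j => ?_⟩
  · obtain ⟨d, hd⟩ := hf.1
    obtain ⟨d', hd'⟩ := hg.1
    refine ⟨d + d', fun m hm => ?_⟩
    rw [MvPowerSeries.coeff_mul]
    refine Finset.sum_eq_zero fun p hp => ?_
    rw [Finset.HasAntidiagonal.mem_antidiagonal] at hp
    have : p.1.degree + p.2.degree = m.degree := by rw [← hp, map_add]
    by_cases h : d < p.1.degree
    · rw [hd _ h, zero_mul]
    · rw [hd' p.2 (by omega), mul_zero]
  · rw [MvPowerSeries.coeff_mul, MvPowerSeries.coeff_mul]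
    have aux : ∀ (i j : Fin k ↪o ℕ) (p : (ℕ →₀ ℕ) × (ℕ →₀ ℕ)),
        p ∈ Finset.HasAntidiagonal.antidiagonal (expo a i) →
        (expo (fun t => p.1 (i t)) j, expo (fun t => p.2 (i t)) j) ∈
          Finset.HasAntidiagonal.antidiagonal (expo a j) := by
      intro i j p hp
      rw [Finset.HasAntidiagonal.mem_antidiagonal] at hp ⊢
      change expo _ j + expo _ j = _
      rw [← expo_add]
      congr 1
      ext t
      have := DFunLike.congr_fun hp (i t)
      rwa [expo_apply] at this
    have le1 : ∀ (i : Fin k ↪o ℕ) (p : (ℕ →₀ ℕ) × (ℕ →₀ ℕ)),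
        p ∈ Finset.HasAntidiagonal.antidiagonal (expo a i) →
        p.1 = expo (fun t => p.1 (i t)) i ∧ p.2 = expo (fun t => p.2 (i t)) i := by
      intro i p hp
      rw [Finset.HasAntidiagonal.mem_antidiagonal] at hp
      exact ⟨eq_expo_of_le (hp ▸ self_le_add_right _ _),
        eq_expo_of_le (hp ▸ self_le_add_left _ _)⟩
    refine Finset.sum_bij'
      (fun p _ => (expo (fun t => p.1 (i t)) j, expo (fun t => p.2 (i t)) j))
      (fun p _ => (expo (fun t => p.1 (j t)) i, expo (fun t => p.2 (j t)) i))
      (aux i j) (aux j i) ?_ ?_ ?_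
    · intro p hp
      simp only [expo_apply]
      exact Prod.ext (le1 i p hp).1.symm (le1 i p hp).2.symm
    · intro p hp
      simp only [expo_apply]
      exact Prod.ext (le1 j p hp).1.symm (le1 j p hp).2.symm
    · intro p hp
      rw [hf.coeff_eq _ j i, hg.coeff_eq _ j i, ← (le1 i p hp).1, ← (le1 i p hp).2]

theorem isQuasisymmetric_algebraMap (r : R) :
    IsQuasisymmetric (algebraMap R (MvPowerSeries ℕ R) r) := by
  classical
  refine ⟨⟨0, fun m hm => ?_⟩, fun k a ha i j => ?_⟩
  · rw [MvPowerSeries.algebraMap_apply, MvPowerSeries.coeff_C, if_neg]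
    rintro rfl
    simp at hm
  · have : expo a i = 0 ↔ expo a j = 0 := by
      rw [← Finsupp.support_eq_empty, ← Finsupp.support_eq_empty, expo_support ha,
        expo_support ha]
      simp
    simp [MvPowerSeries.algebraMap_apply, MvPowerSeries.coeff_C, this]

variable (R) in
/-- The algebra of quasisymmetric functions with coefficients in `R`. -/
def QSym : Subalgebra R (MvPowerSeries ℕ R) where
  carrier := {f | IsQuasisymmetric f}
  mul_mem' hf hg := hf.mul hg
  add_mem' := by
    rintro f g ⟨⟨d, hd⟩, hf⟩ ⟨⟨d', hd'⟩, hg⟩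
    refine ⟨⟨max d d', fun m hm => ?_⟩, fun k a ha i j => ?_⟩
    · rw [map_add, hd m (lt_of_le_of_lt (le_max_left _ _) hm),
        hd' m (lt_of_le_of_lt (le_max_right _ _) hm), add_zero]
    · rw [map_add, map_add, hf k a ha i j, hg k a ha i j]
  algebraMap_mem' := isQuasisymmetric_algebraMap

/-! ### Compositions, the monomial and the fundamental basis -/

/-- Compositions of arbitrary weight, including the empty composition (of weight `0`). -/
abbrev Comp : Type := Σ n : ℕ, Composition n

/-- The sum of the entries in odd position (the first, the third, …) of a list. -/
def oddSum : List ℕ → ℕ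
  | [] => 0
  | [a] => a
  | a :: _ :: l => a + oddSum l

/-- The sum of the entries in even position (the second, the fourth, …) of a list. -/
def evenSum (l : List ℕ) : ℕ := oddSum l.tail

theorem oddSum_cons (a : ℕ) (l : List ℕ) : oddSum (a :: l) = a + evenSum l := by
  cases l <;> rfl

/-- The rank `r(α) = α₁ + α₃ + α₅ + ⋯` of a composition. -/
def rank {n : ℕ} (α : Composition n) : ℕ := oddSum α.blocks

/-- The sum `α₂ + α₄ + ⋯ = |α| - r(α)`. -/
def corank {n : ℕ} (α : Composition n) : ℕ := evenSum α.blocks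

open Classical in
/-- The formal sum of all `x_{i_1}^{α_1} ⋯ x_{i_k}^{α_k}` with `i_1 < ⋯ < i_k`. These monomials are
pairwise distinct, so every coefficient is `0` or `1`. -/
noncomputable def monomialSeries (R : Type*) [CommRing R] {n : ℕ} (α : Composition n) :
    MvPowerSeries ℕ R :=
  fun m => if ∃ i : Fin α.length ↪o ℕ, m = expo α.blocksFun i then 1 else 0

theorem monomialSeries_mem (R : Type*) [CommRing R] {n : ℕ} (α : Composition n) :
    monomialSeries R α ∈ QSym R := by
  classical
  have hc : ∀ m, MvPowerSeries.coeff m (monomialSeries R α) =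
      if ∃ i : Fin α.length ↪o ℕ, m = expo α.blocksFun i then 1 else 0 := fun m => rfl
  have hp : ∀ t, 0 < α.blocksFun t := fun t => α.one_le_blocksFun t
  refine ⟨⟨n, fun m hm => ?_⟩, fun k a ha i j => ?_⟩
  · rw [hc, if_neg]
    rintro ⟨i, rfl⟩
    have : (expo α.blocksFun i).degree = n := by
      rw [expo, map_sum]
      simp [Finsupp.degree_single, α.sum_blocksFun]
    omega
  · have aux : ∀ i j : Fin k ↪o ℕ, (∃ i' : Fin α.length ↪o ℕ, expo a i = expo α.blocksFun i') →
        ∃ i' : Fin α.length ↪o ℕ, expo a j = expo α.blocksFun i' := by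
      rintro i j ⟨i', h⟩
      obtain ⟨e, h⟩ := expo_inj ha hp h
      refine ⟨(Fin.castOrderIso e.symm).toOrderEmbedding.trans j, ?_⟩
      unfold expo
      refine Fintype.sum_equiv (finCongr e) _ _ fun t => ?_
      rw [h t]
      rfl
    rw [hc, hc]
    congr 1
    exact propext ⟨aux i j, aux j i⟩

/-- The monomial quasisymmetric function `x^α`. -/
noncomputable def monomialQ (R : Type*) [CommRing R] {n : ℕ} (α : Composition n) : QSym R :=
  ⟨monomialSeries R α, monomialSeries_mem R α⟩

/-- The fundamental quasisymmetric function `L_α`, the sum of `x^β` over all refinements `β` of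
`α`, that is, over all compositions `β` of the same weight whose set of partial sums contains that
of `α`. -/
noncomputable def fundamentalQ (R : Type*) [CommRing R] {n : ℕ} (α : Composition n) : QSym R :=
  ∑ β : Composition n with α.boundaries ⊆ β.boundaries, monomialQ R β

/-- The run composition `C(π)` of a sequence `π` of distinct integers: the lengths of its
successive maximal increasing runs. -/
def runComposition (π : List ℕ) : Composition π.length where
  blocks := (π.splitBy (fun x y => decide (x < y))).map List.length
  blocks_pos := by
    intro i hi
    obtain ⟨s, hs, rfl⟩ := List.mem_map.1 hi
    exact List.length_pos_of_ne_nil (List.ne_nil_of_mem_splitBy hs)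
  blocks_sum := by
    rw [← List.length_flatten, List.flatten_splitBy]

/-! ### Labeled posets -/

/-- A labeled poset: a partial order, given by its strict part, on a finite set of positive
integers, the labels. -/
structure LabeledPoset where
  labels : Finset ℕ
  lt : ℕ → ℕ → Prop
  label_pos : ∀ x ∈ labels, 0 < x
  mem_of_lt : ∀ x y, lt x y → x ∈ labels ∧ y ∈ labels
  irrefl : ∀ x, ¬ lt x x
  trans : ∀ x y z, lt x y → lt y z → lt x z

open Classical in
/-- The Jordan–Hölder set `ℒ(P)`: all arrangements `π` of the labels that are linear extensions of
`P`, that is, no element of `π` is followed, immediately or later, by a `P`-smaller one. -/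
noncomputable def LabeledPoset.jordanHolder (P : LabeledPoset) : Finset (List ℕ) :=
  {π ∈ P.labels.val.lists.toFinset | π.Pairwise (fun x y => ¬ P.lt y x)}

/-- The quasisymmetric function `F(P)` of a labeled poset. -/
noncomputable def LabeledPoset.F (R : Type*) [CommRing R] (P : LabeledPoset) : QSym R :=
  ∑ π ∈ P.jordanHolder, fundamentalQ R (runComposition π)

/-- The ordinal sum `K₁ ⊕ ⋯ ⊕ K_k` of pairwise disjoint sets of labels, each an antichain. -/
def ordinalSum (K : List (Finset ℕ)) (hK : K.Pairwise Disjoint)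
    (hpos : ∀ B ∈ K, ∀ x ∈ B, 0 < x) : LabeledPoset where
  labels := Finset.univ.biUnion fun i : Fin K.length => K.get i
  lt x y := ∃ i j : Fin K.length, i < j ∧ x ∈ K.get i ∧ y ∈ K.get j
  label_pos := by
    intro x hx
    obtain ⟨i, -, hi⟩ := Finset.mem_biUnion.1 hx
    exact hpos _ (List.get_mem K i) x hi
  mem_of_lt := by
    rintro x y ⟨i, j, -, hi, hj⟩
    exact ⟨Finset.mem_biUnion.2 ⟨i, Finset.mem_univ _, hi⟩,
      Finset.mem_biUnion.2 ⟨j, Finset.mem_univ _, hj⟩⟩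
  irrefl := by
    rintro x ⟨i, j, hij, hi, hj⟩
    exact Finset.disjoint_left.1 (List.pairwise_iff_get.1 hK i j hij) hi hj
  trans := by
    rintro x y z ⟨i, j, hij, hi, hj⟩ ⟨i', j', hij', hi', hj'⟩
    have : j = i' := by
      rcases lt_trichotomy j i' with h | h | h
      · exact (Finset.disjoint_left.1 (List.pairwise_iff_get.1 hK _ _ h) hj hi').elim
      · exact h
      · exact (Finset.disjoint_left.1 (List.pairwise_iff_get.1 hK _ _ h) hi' hj).elim
    subst this
    exact ⟨i, j', hij.trans hij', hi, hj'⟩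

/-- The disjoint sum of two labeled posets with disjoint sets of labels. -/
def disjointSum (P Q : LabeledPoset) (h : Disjoint P.labels Q.labels) : LabeledPoset where
  labels := P.labels ∪ Q.labels
  lt x y := P.lt x y ∨ Q.lt x y
  label_pos := by
    intro x hx
    rcases Finset.mem_union.1 hx with hx | hx
    · exact P.label_pos x hx
    · exact Q.label_pos x hx
  mem_of_lt := by
    rintro x y (hx | hx)
    · exact (P.mem_of_lt x y hx).imp (Finset.mem_union_left _) (Finset.mem_union_left _)
    · exact (Q.mem_of_lt x y hx).imp (Finset.mem_union_right _) (Finset.mem_union_right _)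
  irrefl := by
    rintro x (hx | hx)
    · exact P.irrefl x hx
    · exact Q.irrefl x hx
  trans := by
    rintro x y z (h1 | h1) (h2 | h2)
    · exact Or.inl (P.trans x y z h1 h2)
    · exact (Finset.disjoint_left.1 h (P.mem_of_lt _ _ h1).2 (Q.mem_of_lt _ _ h2).1).elim
    · exact (Finset.disjoint_left.1 h (P.mem_of_lt _ _ h2).1 (Q.mem_of_lt _ _ h1).2).elim
    · exact Or.inr (Q.trans x y z h1 h2)

/-! ### The alternating labeling and the basis `N_α` -/

/-- Sets of labels of given sizes, numbered in alternating fashion: the sets in odd position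
(the first, the third, …) take up successive integers starting at `o + 1`, those in even position
successive integers starting at `e + 1`. -/
def altBlocks : ℕ → ℕ → List ℕ → List (Finset ℕ)
  | _, _, [] => []
  | o, e, a :: l => Finset.Ioc o (o + a) :: altBlocks e (o + a) l

theorem mem_altBlocks : ∀ (l : List ℕ) (o e : ℕ), ∀ B ∈ altBlocks o e l, ∀ x ∈ B,
    (o < x ∧ x ≤ o + oddSum l) ∨ (e < x ∧ x ≤ e + evenSum l)
  | [], _, _, B, hB, _, _ => by simp [altBlocks] at hB
  | a :: l, o, e, B, hB, x, hx => by
    have h1 : evenSum (a :: l) = oddSum l := rfl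
    rw [oddSum_cons, h1]
    rcases List.mem_cons.1 hB with rfl | hB
    · rw [Finset.mem_Ioc] at hx
      omega
    · have := mem_altBlocks l e (o + a) B hB x hx
      omega

theorem pairwise_altBlocks : ∀ (l : List ℕ) (o e : ℕ),
    e + evenSum l ≤ o ∨ o + oddSum l ≤ e → (altBlocks o e l).Pairwise Disjoint
  | [], _, _, _ => List.Pairwise.nil
  | a :: l, o, e, h => by
    have h1 : evenSum (a :: l) = oddSum l := rfl
    rw [oddSum_cons, h1] at h
    refine List.Pairwise.cons (fun B hB => ?_) (pairwise_altBlocks l e (o + a) (by omega))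
    refine Finset.disjoint_left.2 fun x hx hxB => ?_
    have := mem_altBlocks l e (o + a) B hB x hxB
    rw [Finset.mem_Ioc] at hx
    omega

/-- The ordinal sum of antichains whose sizes are the entries of `l`, with the alternating
labeling that starts at `o + 1` in odd and at `e + 1` in even position. -/
def altPoset (o e : ℕ) (l : List ℕ) (h : e + evenSum l ≤ o) : LabeledPoset :=
  ordinalSum (altBlocks o e l) (pairwise_altBlocks l o e (Or.inl h)) fun B hB x hx => by
    have := mem_altBlocks l o e B hB x hx
    omega

theorem mem_altPoset {o e : ℕ} {l : List ℕ} {h : e + evenSum l ≤ o} {x : ℕ}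
    (hx : x ∈ (altPoset o e l h).labels) :
    (o < x ∧ x ≤ o + oddSum l) ∨ (e < x ∧ x ≤ e + evenSum l) := by
  obtain ⟨i, -, hi⟩ := Finset.mem_biUnion.1 hx
  exact mem_altBlocks l o e _ (List.get_mem _ i) x hi

/-- The labeled poset `P_α = A₁ ⊕ A₂ ⊕ ⋯`, where `A_i` is an antichain with `α_i` elements; the
elements of `A₂, A₄, …` are numbered first, followed by those of `A₁, A₃, …`. -/
def posetP {n : ℕ} (α : Composition n) : LabeledPoset :=
  altPoset (corank α) 0 α.blocks (Nat.zero_add _).le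

/-- `N_α = F(P_α)`. For the empty composition this is `L_𝟎 = 1`. -/
noncomputable def N (R : Type*) [CommRing R] {n : ℕ} (α : Composition n) : QSym R :=
  (posetP α).F R

/-- The span of all `N_α` with `α` of rank `r`. -/
noncomputable def rankPiece (R : Type*) [CommRing R] (r : ℕ) : Submodule R (QSym R) :=
  Submodule.span R {f | ∃ α : Comp, rank α.2 = r ∧ N R α.2 = f}

/-! ### Induced ordered partitions -/

/-- The ordered partition `K_T(π)` that an unordered partition `T` induces on `π`: cut `π` into
maximal segments of consecutive elements lying in a common block of `T`, and replace each segment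
by its set of elements. -/
def inducedPartition (T : Finset (Finset ℕ)) (π : List ℕ) : List (Finset ℕ) :=
  (π.splitBy (fun x y => decide (∃ B ∈ T, x ∈ B ∧ y ∈ B))).map List.toFinset

/-- The set `𝕂_{P,T}` of all ordered partitions induced by `T` on linear extensions of `P`. -/
noncomputable def inducedPartitions (P : LabeledPoset) (T : Finset (Finset ℕ)) :
    Finset (List (Finset ℕ)) :=
  P.jordanHolder.image (inducedPartition T)

/-- An ordered partition `K₁, K₂, …` is alternating if the elements of `K_i` are larger than those
of `K_{i+1}` for odd `i`, and smaller for even `i` (here positions are counted from `0`). -/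
def IsAlternating (K : List (Finset ℕ)) : Prop :=
  ∀ (i : ℕ) (hi : i + 1 < K.length), ∀ x ∈ K[i], ∀ y ∈ K[i + 1],
    if Even i then y < x else x < y

/-- The antichains `A₁, A₂, …` of `P_α`, relabeled as part of `posetQ α β`. -/
def blocksA {m n : ℕ} (α : Composition m) (β : Composition n) : List (Finset ℕ) :=
  altBlocks (corank α + corank β) 0 α.blocks

/-- The antichains `B₁, B₂, …` of `P_β`, relabeled as part of `posetQ α β`. -/
def blocksB {m n : ℕ} (α : Composition m) (β : Composition n) : List (Finset ℕ) :=
  altBlocks (corank α + corank β + rank α) (corank α) β.blocks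

/-- The disjoint sum of `P_α = A₁ ⊕ A₂ ⊕ ⋯` and `P_β = B₁ ⊕ B₂ ⊕ ⋯`, labeled so that the elements
of `A₂, A₄, …, B₂, B₄, …` come first, followed by those of `A₁, A₃, …, B₁, B₃, …`. -/
def posetQ {m n : ℕ} (α : Composition m) (β : Composition n) : LabeledPoset :=
  disjointSum
    (altPoset (corank α + corank β) 0 α.blocks
      (by change 0 + corank α ≤ _; omega))
    (altPoset (corank α + corank β + rank α) (corank α) β.blocks
      (by change corank α + corank β ≤ _; omega))
    (Finset.disjoint_left.2 fun x hx hy => by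
      have h1 := mem_altPoset hx
      have h2 := mem_altPoset hy
      change (_ ∧ _ ≤ _ + rank α) ∨ (_ ∧ _ ≤ _ + corank α) at h1
      change (_ ∧ _ ≤ _ + rank β) ∨ (_ ∧ _ ≤ _ + corank β) at h2
      omega)

/-- The union of the sets in odd position (the first, the third, …). -/
def oddUnion : List (Finset ℕ) → Finset ℕ
  | [] => ∅
  | [A] => A
  | A :: _ :: l => A ∪ oddUnion l

/-- The union of the sets in even position (the second, the fourth, …). -/
def evenUnion (l : List (Finset ℕ)) : Finset ℕ := oddUnion l.tail

/-- The unordered partition `{T₁, T₂}` of the labels of `posetQ α β`: `T₁` is the union of all `A_i`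
and `B_i` with `i` odd, `T₂` the union of those with `i` even (an empty `T₁` or `T₂` plays no
role). -/
def partitionT {m n : ℕ} (α : Composition m) (β : Composition n) : Finset (Finset ℕ) :=
  {oddUnion (blocksA α β) ∪ oddUnion (blocksB α β),
    evenUnion (blocksA α β) ∪ evenUnion (blocksB α β)}

/-- The number of ordered partitions of type `ν` in `𝕂_{Q,T}`, for `Q = posetQ α β` and
`T = partitionT α β`. -/
noncomputable def structureCount {m n k : ℕ} (α : Composition m) (β : Composition n)
    (ν : Composition k) : ℕ :=
  {K ∈ inducedPartitions (posetQ α β) (partitionT α β) | K.map Finset.card = ν.blocks}.card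

end QSymN

namespace QSymN

variable {R : Type*} [CommRing R]

/-! ### Triangular families -/

/-! Products. The coefficient of a monomial in `F(P)` counts the `P`-partitions with that content
(`coeff_F`): sorting the labels by the key `(f x, x)` attaches to every `P`-partition `f` exactly
one linear extension, along which `f` increases weakly, and strictly at the descents. A
`P`-partition of a disjoint sum is a pair of `P`-partitions, so `F` turns disjoint sums into
products (`F_mul_F`), and `N_α N_β = F(Q)`.

The labels of `T₁` are exactly those exceeding the threshold `c = |α| - r(α) + |β| - r(β)`, so `K_T`
cuts a linear extension wherever it crosses `c`. Between two comparable elements of `Q` on the same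
side of `c` lies one on the other side; hence the elements of one segment are pairwise incomparable.
It follows that the linear extensions of `Q` inducing a given `K` are all linear extensions of the
ordinal sum `K₁ ⊕ K₂ ⊕ ⋯` (`mem_jordanHolder_and_iff`). A linear extension starts above `c`, because
minimal elements of `Q` lie there, and then the segments change sides at every cut, so `K` is
alternating. For alternating ordinal sums of nonempty antichains `F` depends only on the block sizes
(`F_ordinalSum_congr`): a relabeling that increases on each block preserves ascents and descents. So
the fiber over `K` contributes `N_ν` with `ν` the type of `K`. The rank of `ν` counts the labels
above `c`, which is `r(α) + r(β)`.

Basis. The `L_α` are unitriangular over the monomial basis by refinement. The `N_α` are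
unitriangular over the `L_α` for a less obvious matching: let `zigzag α` list the odd antichains of
`P_α` increasingly and the even ones decreasingly. In any linear extension of `P_α` the comparisons
at the joints of blocks are forced to be descent, ascent, descent, and so on. Comparing words, if
some linear extension of `P_α` has the ascents of `zigzag β`, then `β ≤ α` lexicographically, and
for `β = α` there is only one such extension. Antisymmetry makes `α ↦ C(zigzag α)` injective, hence
bijective on the finite set of compositions of each weight, and `N_α` is unitriangular over the `L`
reindexed along it.

The grading follows: the pieces are spanned by disjoint parts of a basis, and the product formula
adds ranks. -/

theorem exists_basis_of_triangular {ι M : Type*} [AddCommGroup M] [Module R M]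
    (b : Module.Basis ι R M) (v : ι → M) (r : ι → ι → Prop) (hwf : WellFounded r)
    (htr : ∀ i j k, r i j → r j k → r i k) (hdiag : ∀ i, b.repr (v i) i = 1)
    (htri : ∀ i j, b.repr (v i) j ≠ 0 → j = i ∨ r j i) :
    ∃ b' : Module.Basis ι R M, ⇑b' = v := by
  classical
  have hirr : ∀ i, ¬ r i i := fun i h => hwf.irrefl.irrefl i h
  have hli : LinearIndependent R v := by
    rw [linearIndependent_iff']
    intro s g hg
    by_contra! hne
    obtain ⟨i₀, hi₀, hgi₀⟩ := hne
    have : IsStrictOrder ι (Function.swap r) :=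
      { irrefl := hirr, trans := fun i j k h1 h2 => htr k j i h2 h1 }
    have hw := (s.filter (fun i => g i ≠ 0)).wellFoundedOn (r := Function.swap r)
    -- Take `i` maximal among the indices with nonzero coefficient. By triangularity no other vector
    -- of the relation has a component at `i`, so coordinate `i` isolates `g i`.
    obtain ⟨⟨i, hi⟩, -, hmax⟩ := WellFounded.has_min hw Set.univ
      ⟨⟨i₀, by simpa using ⟨hi₀, hgi₀⟩⟩, trivial⟩
    simp only [Finset.coe_filter, Set.mem_ofPred_eq] at hi
    refine hi.2 ?_
    have h1 := DFunLike.congr_fun (congrArg b.repr hg) i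
    rw [map_sum, Finsupp.finsetSum_apply, Finset.sum_eq_single i] at h1
    · simpa [hdiag] using h1
    · intro k hk hki
      rw [map_smul, Finsupp.smul_apply, smul_eq_mul]
      by_contra hne
      have hgk : g k ≠ 0 := fun h => hne (by rw [h, zero_mul])
      rcases htri k i (fun h => hne (by rw [h, mul_zero])) with h | h
      · exact hki h.symm
      · exact hmax ⟨k, by simpa using ⟨hk, hgk⟩⟩ trivial h
    · exact fun h => absurd hi.1 h
  have hspan : ∀ i, b i ∈ Submodule.span R (Set.range v) := by
    intro i
    induction i using hwf.induction with
    | _ i ih =>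
      have h1 := b.linearCombination_repr (v i)
      rw [Finsupp.linearCombination_apply, Finsupp.sum] at h1
      have h2 : b i = v i - ∑ j ∈ (b.repr (v i)).support.erase i, b.repr (v i) j • b j := by
        rw [eq_sub_iff_add_eq]
        refine Eq.trans ?_ h1
        by_cases hi : i ∈ (b.repr (v i)).support
        · rw [← Finset.add_sum_erase _ _ hi, hdiag, one_smul]
        -- The diagonal coefficient is `1`, so it can be missing from the support only over the zero
        -- ring, where every term vanishes.
        · have h0 : (1 : R) = 0 := by
            rw [← hdiag i]
            exact Finsupp.notMem_support_iff.1 hi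
          rw [Finset.erase_eq_of_notMem hi, ← one_smul R (b i), h0, zero_smul, zero_add]
      rw [h2]
      refine Submodule.sub_mem _ (Submodule.subset_span ⟨i, rfl⟩)
        (Submodule.sum_mem _ fun j hj => Submodule.smul_mem _ _ (ih j ?_))
      rw [Finset.mem_erase, Finsupp.mem_support_iff] at hj
      exact (htri i j hj.2).resolve_left hj.1
  refine ⟨Module.Basis.mk hli ?_, Module.Basis.coe_mk _ _⟩
  rw [← b.span_eq, Submodule.span_le]
  rintro _ ⟨i, rfl⟩
  exact hspan i

/-! ### The monomial basis -/

theorem coeff_monomialQ {n : ℕ} (α : Composition n) (m : ℕ →₀ ℕ)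
    [Decidable (∃ i : Fin α.length ↪o ℕ, m = expo α.blocksFun i)] :
    MvPowerSeries.coeff m (monomialQ R α : MvPowerSeries ℕ R) =
      if ∃ i : Fin α.length ↪o ℕ, m = expo α.blocksFun i then 1 else 0 := by
  rw [show MvPowerSeries.coeff m (monomialQ R α : MvPowerSeries ℕ R) =
    @ite _ (∃ i : Fin α.length ↪o ℕ, m = expo α.blocksFun i) (Classical.propDecidable _) 1 0 from rfl]
  congr

theorem degree_expo {n : ℕ} (α : Composition n) (i : Fin α.length ↪o ℕ) :
    (expo α.blocksFun i).degree = n := by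
  rw [expo, map_sum]
  simp [Finsupp.degree_single, α.sum_blocksFun]

/-- The nonzero exponents, read in the order of the variables, form the composition; the increasing
enumeration of the support gives the indices. -/
theorem exists_eq_expo (m : ℕ →₀ ℕ) :
    ∃ (α : Comp) (i : Fin α.2.length ↪o ℕ), m = expo α.2.blocksFun i := by
  let e := m.support.orderEmbOfFin rfl
  let l := List.ofFn (m ∘ e)
  have hl : l.length = m.support.card := List.length_ofFn
  let α : Comp := ⟨l.sum, l, by
    intro x hx
    obtain ⟨t, rfl⟩ := (List.mem_ofFn' _ _).1 hx
    exact Nat.pos_of_ne_zero (Finsupp.mem_support_iff.1 (m.support.orderEmbOfFin_mem rfl t)), rfl⟩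
  refine ⟨α, (Fin.castOrderIso hl).toOrderEmbedding.trans e, ?_⟩
  have h1 : m = ∑ t, Finsupp.single (e t) (m (e t)) := by
    conv_lhs => rw [← m.sum_single, Finsupp.sum]
    rw [← Finset.sum_coe_sort]
    exact (Fintype.sum_equiv (m.support.orderIsoOfFin rfl).toEquiv _ _ fun t => rfl).symm
  conv_lhs => rw [h1]
  unfold expo
  refine (Fintype.sum_equiv (finCongr hl) _ _ fun t => ?_).symm
  simp only [Composition.blocksFun]
  congr 1
  exact List.get_ofFn _ _

theorem comp_eq_of_expo_eq {n k : ℕ} {α : Composition n} {β : Composition k}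
    {i : Fin α.length ↪o ℕ} {j : Fin β.length ↪o ℕ}
    (h : expo α.blocksFun i = expo β.blocksFun j) : (⟨n, α⟩ : Comp) = ⟨k, β⟩ := by
  obtain ⟨e, h⟩ := expo_inj (fun t => α.one_le_blocksFun t) (fun t => β.one_le_blocksFun t) h
  rw [Composition.sigma_eq_iff_blocks_eq]
  refine List.ext_get e fun t h1 h2 => ?_
  exact h ⟨t, h1⟩

/-- The exponent `x_0 ^ α₁ x_1 ^ α₂ ⋯`. -/
noncomputable def stdExpo {n : ℕ} (α : Composition n) : ℕ →₀ ℕ :=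
  expo α.blocksFun (Fin.valOrderEmb _)

theorem coeff_stdExpo_monomialQ (α β : Comp) [Decidable (β = α)] :
    MvPowerSeries.coeff (stdExpo α.2) (monomialQ R β.2 : MvPowerSeries ℕ R) =
      if β = α then 1 else 0 := by
  classical
  rw [coeff_monomialQ]
  congr 1
  refine propext ⟨fun ⟨i, h⟩ => (comp_eq_of_expo_eq h).symm, ?_⟩
  rintro rfl
  exact ⟨_, rfl⟩

variable (R) in
-- The coefficients at the exponents `stdExpo α` are dual to the family.
theorem linearIndependent_monomialQ :
    LinearIndependent R (fun α : Comp => monomialQ R α.2) := by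
  classical
  rw [linearIndependent_iff']
  intro s g hg α hα
  have := congrArg (fun f : QSym R => MvPowerSeries.coeff (stdExpo α.2) (f : MvPowerSeries ℕ R)) hg
  simpa [coeff_stdExpo_monomialQ, hα] using this

variable (R) in
-- By quasisymmetry a series is determined by its coefficients at the exponents `stdExpo α`; bounded
-- degree leaves finitely many of them.
theorem span_monomialQ :
    ⊤ ≤ Submodule.span R (Set.range fun α : Comp => monomialQ R α.2) := by
  classical
  rintro ⟨f, hf⟩ -
  obtain ⟨d, hd⟩ := hf.1
  have key : (⟨f, hf⟩ : QSym R) =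
      ∑ α ∈ (Finset.range (d + 1)).sigma (fun n => (Finset.univ : Finset (Composition n))),
        MvPowerSeries.coeff (stdExpo α.2) f • monomialQ R α.2 := by
    refine Subtype.ext (MvPowerSeries.ext fun m => ?_)
    obtain ⟨β, i, rfl⟩ := exists_eq_expo m
    have hβ : MvPowerSeries.coeff (expo β.2.blocksFun i) f =
        MvPowerSeries.coeff (stdExpo β.2) f := hf.coeff_eq _ _ _
    simp only [AddSubmonoidClass.coe_finsetSum, map_sum, SetLike.val_smul, map_smul, coeff_monomialQ,
      smul_eq_mul, mul_ite, mul_one, mul_zero]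
    rw [Finset.sum_eq_single β]
    · rw [if_pos ⟨i, rfl⟩, hβ]
    · rintro α - hne
      rw [if_neg]
      rintro ⟨j, hj⟩
      exact hne (comp_eq_of_expo_eq hj).symm
    · intro hn
      rw [if_pos ⟨i, rfl⟩, ← hβ]
      refine hd _ ?_
      rw [degree_expo]
      simpa using hn
  rw [key]
  exact Submodule.sum_mem _ fun α _ => Submodule.smul_mem _ _ (Submodule.subset_span ⟨α, rfl⟩)

variable (R) in
/-- The basis of `QSym R` formed by the monomial quasisymmetric functions. -/
noncomputable def monomialBasis : Module.Basis Comp R (QSym R) :=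
  Module.Basis.mk (linearIndependent_monomialQ R) (span_monomialQ R)

theorem monomialBasis_apply (α : Comp) : monomialBasis R α = monomialQ R α.2 :=
  Module.Basis.mk_apply _ _ _

theorem QSym_ext {f g : QSym R} (h : ∀ m, MvPowerSeries.coeff m (f : MvPowerSeries ℕ R) =
    MvPowerSeries.coeff m (g : MvPowerSeries ℕ R)) : f = g :=
  Subtype.ext (MvPowerSeries.ext h)

/-! ### Coefficients of the fundamental quasisymmetric functions -/

/-- `j` is one of the partial sums of `α`. -/
def IsPartialSum {n : ℕ} (α : Composition n) (j : ℕ) : Prop :=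
  ∃ i, α.sizeUpTo i = j

theorem mem_boundaries_iff {n : ℕ} (α : Composition n) (j : Fin (n + 1)) :
    j ∈ α.boundaries ↔ IsPartialSum α j := by
  simp only [Composition.boundaries, Finset.mem_map, Finset.mem_univ, true_and]
  constructor
  · rintro ⟨t, rfl⟩
    exact ⟨t, rfl⟩
  · rintro ⟨i, h⟩
    -- Past the last block `sizeUpTo` stays at `n`, so a large `i` yields the final boundary.
    rcases le_or_gt i α.length with hi | hi
    · exact ⟨⟨i, Nat.lt_succ_iff.2 hi⟩, Fin.ext h⟩
    · rw [α.sizeUpTo_ofLength_le i hi.le] at h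
      exact ⟨Fin.last _, Fin.ext (by rw [← h]; exact α.sizeUpTo_length)⟩

/-- A cut after `j + 1` positions separates the positions `j` and `j + 1`, counted from `0`, into
different blocks. -/
theorem isPartialSum_succ_iff {n : ℕ} (α : Composition n) {j : ℕ} (hj : j + 1 < n) :
    IsPartialSum α (j + 1) ↔ α.index ⟨j, Nat.lt_of_succ_lt hj⟩ ≠ α.index ⟨j + 1, hj⟩ := by
  have h1 := α.lt_sizeUpTo_index_succ ⟨j, Nat.lt_of_succ_lt hj⟩
  have h2 := α.sizeUpTo_index_le ⟨j, Nat.lt_of_succ_lt hj⟩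
  have h3 := α.lt_sizeUpTo_index_succ ⟨j + 1, hj⟩
  have h4 := α.sizeUpTo_index_le ⟨j + 1, hj⟩
  simp only [Fin.val_succ] at h1 h2 h3 h4
  constructor
  · rintro ⟨i, h⟩ he
    rw [← he] at h3 h4
    rcases le_or_gt i (α.index ⟨j, Nat.lt_of_succ_lt hj⟩) with hle | hlt
    · have := α.monotone_sizeUpTo hle
      omega
    · have := α.monotone_sizeUpTo (Nat.succ_le_of_lt hlt)
      simp only [Nat.succ_eq_add_one] at this h3
      omega
  · intro hne
    have hlt : (α.index ⟨j, Nat.lt_of_succ_lt hj⟩ : ℕ) < α.index ⟨j + 1, hj⟩ := by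
      refine lt_of_le_of_ne ?_ fun h => hne (Fin.ext h)
      by_contra! hlt
      have := α.monotone_sizeUpTo (Nat.succ_le_of_lt hlt)
      simp only [Nat.succ_eq_add_one] at this h3
      omega
    have := α.monotone_sizeUpTo (Nat.succ_le_of_lt hlt)
    simp only [Nat.succ_eq_add_one] at this h1
    exact ⟨_, le_antisymm (this.trans h4) h1⟩

/-- Both `0` and `n` are boundaries of every composition, so only interior partial sums matter. -/
theorem boundaries_subset_iff {n : ℕ} (α β : Composition n) :
    α.boundaries ⊆ β.boundaries ↔
      ∀ j, j + 1 < n → IsPartialSum α (j + 1) → IsPartialSum β (j + 1) := by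
  constructor
  · intro h j hj hm
    exact (mem_boundaries_iff β ⟨j + 1, by omega⟩).1 (h ((mem_boundaries_iff α _).2 hm))
  · rintro h ⟨j, hj⟩ hm
    rw [mem_boundaries_iff] at hm ⊢
    rcases j with _ | j
    · exact ⟨0, β.sizeUpTo_zero⟩
    · rcases lt_or_eq_of_le (Nat.lt_succ_iff.1 hj) with hlt | rfl
      · exact h j hlt hm
      · exact ⟨_, β.sizeUpTo_length⟩

theorem monotone_index {n : ℕ} (α : Composition n) : Monotone α.index := by
  intro a b hab
  by_contra! hlt
  have h1 := α.monotone_sizeUpTo (Nat.succ_le_of_lt (Fin.lt_def.1 hlt))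
  have h2 := α.sizeUpTo_index_le a
  have h3 := α.lt_sizeUpTo_index_succ b
  simp only [Nat.succ_eq_add_one, Fin.val_succ] at h1 h3
  have := Fin.le_def.1 hab
  omega

theorem sum_single_index {n : ℕ} (α : Composition n) (i : Fin α.length ↪o ℕ) :
    ∑ j : Fin n, Finsupp.single (i (α.index j)) 1 = expo α.blocksFun i := by
  rw [← α.blocksFinEquiv.sum_comp, Fintype.sum_sigma, expo]
  refine Finset.sum_congr rfl fun t _ => ?_
  have : ∀ s, α.index (α.blocksFinEquiv ⟨t, s⟩) = t := fun s => α.index_embedding t s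
  simp [this]

/-- A weakly increasing sequence is the sorted list of the multiset that its content encodes. -/
theorem eq_of_monotone_of_sum_single_eq {n : ℕ} {v w : Fin n → ℕ} (hv : Monotone v)
    (hw : Monotone w)
    (h : ∑ j, Finsupp.single (v j) 1 = (∑ j, Finsupp.single (w j) 1 : ℕ →₀ ℕ)) : v = w := by
  have key : ∀ u : Fin n → ℕ, Finsupp.toMultiset (∑ j, Finsupp.single (u j) 1) =
      (List.ofFn u : Multiset ℕ) := by
    intro u
    have h1 : (List.ofFn u : Multiset ℕ) = Finset.univ.val.map u := by
      rw [List.ofFn_eq_map, ← Multiset.map_coe]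
      rfl
    have h2 : ∀ s : Multiset (Fin n), (s.map fun j => ({u j} : Multiset ℕ)).sum = s.map u := by
      intro s
      induction s using Multiset.induction_on with
      | empty => simp
      | cons a s ih => simp [ih]
    rw [map_sum, h1]
    simp only [Finsupp.toMultiset_single, one_smul]
    exact h2 _
  have h2 := congrArg Finsupp.toMultiset h
  rw [key, key, Multiset.coe_eq_coe] at h2
  exact List.ofFn_injective (h2.eq_of_sortedLE hv.sortedLE_ofFn hw.sortedLE_ofFn)

/-- There is a weakly increasing sequence with content `m` that increases strictly at the partial
sums of `α`. -/
def IsCompatible {n : ℕ} (α : Composition n) (m : ℕ →₀ ℕ) : Prop :=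
  ∃ w : Fin n → ℕ, Monotone w ∧ ∑ j, Finsupp.single (w j) 1 = m ∧
    ∀ (j : ℕ) (hj : j + 1 < n), IsPartialSum α (j + 1) →
      w ⟨j, Nat.lt_of_succ_lt hj⟩ < w ⟨j + 1, hj⟩

/-- Exactly one composition `β` has `m` among the monomials of `x^β`. The weakly increasing sequence
with content `m` jumps precisely at the interior partial sums of `β`, so compatibility with `α` says
that `β` refines `α`. -/
theorem coeff_fundamentalQ {n : ℕ} (α : Composition n) (m : ℕ →₀ ℕ)
    [Decidable (IsCompatible α m)] :
    MvPowerSeries.coeff m (fundamentalQ R α : MvPowerSeries ℕ R) =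
      if IsCompatible α m then 1 else 0 := by
  classical
  have huniq : ∀ (β : Composition n) (i : Fin β.length ↪o ℕ) (j : ℕ) (hj : j + 1 < n),
      IsPartialSum β (j + 1) ↔
        i (β.index ⟨j, Nat.lt_of_succ_lt hj⟩) < i (β.index ⟨j + 1, hj⟩) := by
    intro β i j hj
    rw [isPartialSum_succ_iff β hj, i.lt_iff_lt]
    exact ⟨fun h => lt_of_le_of_ne (monotone_index β (Fin.le_def.2 (Nat.le_succ j))) h, fun h => h.ne⟩
  simp only [fundamentalQ, AddSubmonoidClass.coe_finsetSum, map_sum, coeff_monomialQ]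
  split_ifs with h
  · obtain ⟨w, hw, rfl, hα⟩ := h
    obtain ⟨⟨k, β⟩, i, hi⟩ := exists_eq_expo (∑ j, Finsupp.single (w j) 1)
    obtain rfl : n = k := by
      have := congrArg Finsupp.degree hi
      rw [degree_expo, map_sum] at this
      simpa [Finsupp.degree_single] using this
    have hwi : w = fun j => i (β.index j) := by
      refine eq_of_monotone_of_sum_single_eq hw (i.monotone.comp (monotone_index β)) ?_
      rw [hi]
      exact (sum_single_index β i).symm
    rw [Finset.sum_eq_single β, if_pos ⟨i, hi⟩]
    · intro γ _ hne
      rw [if_neg]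
      rintro ⟨i', hi'⟩
      have := comp_eq_of_expo_eq (hi.symm.trans hi')
      simp only [Sigma.mk.injEq, heq_eq_eq, true_and] at this
      exact hne this.symm
    · intro hn
      refine absurd ?_ hn
      rw [Finset.mem_filter]
      refine ⟨Finset.mem_univ _, (boundaries_subset_iff _ _).2 fun j hj hm => ?_⟩
      rw [huniq β i j hj]
      have := hα j hj hm
      rwa [hwi] at this
  · refine Finset.sum_eq_zero fun β hβ => if_neg ?_
    rintro ⟨i, rfl⟩
    rw [Finset.mem_filter] at hβ
    exact h ⟨fun j => i (β.index j), i.monotone.comp (monotone_index β), sum_single_index β i,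
      fun j hj hm => (huniq β i j hj).1 ((boundaries_subset_iff _ _).1 hβ.2 j hj hm)⟩

/-! ### Descents and runs -/

/-- This identifies the partial sums of segment lengths with the places where `r` fails. By
recursion on the segments, the two compared entries lie inside the first segment, at its joint with
the second, or beyond the first segment. -/
theorem exists_sum_take_eq_iff {r : ℕ → ℕ → Bool} : ∀ S : List (List ℕ), (∀ s ∈ S, s ≠ []) →
    (∀ s ∈ S, s.IsChain fun x y => r x y) →
    (S.IsChain fun a b => ∃ ha hb, r (a.getLast ha) (b.head hb) = false) →
    ∀ (j : ℕ) (hj : j + 1 < S.flatten.length),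
      (∃ i, ((S.map List.length).take i).sum = j + 1) ↔
        r (S.flatten[j]) (S.flatten[j + 1]) = false
  | [], _, _, _, j, hj => by simp at hj
  | s :: S, hne, hch, hbt, j, hj => by
    have hs : 0 < s.length := List.length_pos_of_ne_nil (hne s List.mem_cons_self)
    have ih := exists_sum_take_eq_iff S (fun t ht => hne t (List.mem_cons_of_mem _ ht))
      (fun t ht => hch t (List.mem_cons_of_mem _ ht)) hbt.of_cons
    have hex : (∃ i, (((s :: S).map List.length).take i).sum = j + 1) ↔
        ∃ i, s.length + ((S.map List.length).take i).sum = j + 1 := by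
      constructor
      · rintro ⟨i, h⟩
        rcases i with _ | i
        · simp at h
        · exact ⟨i, by simpa using h⟩
      · rintro ⟨i, h⟩
        exact ⟨i + 1, by simpa using h⟩
    rw [hex]
    simp only [List.flatten_cons, List.length_append] at hj
    simp only [List.flatten_cons]
    rcases lt_trichotomy (j + 1) s.length with h | h | h
    · rw [List.getElem_append_left h, List.getElem_append_left (by omega)]
      have := List.isChain_iff_getElem.1 (hch s List.mem_cons_self) j h
      simp only [this, Bool.true_eq_false, iff_false]
      rintro ⟨i, hi⟩
      omega
    · obtain ⟨t, S', rfl⟩ : ∃ t S', S = t :: S' := by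
        cases S with
        | nil => simp at hj; omega
        | cons t S' => exact ⟨t, S', rfl⟩
      have ht : 0 < t.length := List.length_pos_of_ne_nil (hne t (by simp))
      obtain ⟨ha, hb, hr⟩ := (List.isChain_cons_cons.1 hbt).1
      rw [List.getElem_append_left (by omega), List.getElem_append_right (by omega)]
      have h1 : s[j] = s.getLast ha := by
        rw [List.getLast_eq_getElem]
        congr 1
        omega
      have h2 : (t :: S').flatten[j + 1 - s.length]'(by simp; omega) = t.head hb := by
        rw [List.head_eq_getElem]
        simp only [List.flatten_cons]
        rw [List.getElem_append_left (by omega)]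
        congr 1
        omega
      rw [h1, h2, hr]
      exact iff_of_true ⟨0, by simp [h]⟩ rfl
    · rw [List.getElem_append_right (by omega), List.getElem_append_right (by omega)]
      have h3 : j + 1 - s.length = (j - s.length) + 1 := by omega
      simp only [h3]
      rw [← ih (j - s.length) (by omega)]
      refine exists_congr fun i => ?_
      omega

theorem isPartialSum_runComposition (π : List ℕ) {j : ℕ} (hj : j + 1 < π.length) :
    IsPartialSum (runComposition π) (j + 1) ↔ ¬ π[j] < π[j + 1] := by
  have h := exists_sum_take_eq_iff (r := fun x y => decide (x < y))
    (π.splitBy fun x y => decide (x < y)) (fun s hs => List.ne_nil_of_mem_splitBy hs)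
    (fun s hs => List.isChain_of_mem_splitBy hs)
    (List.isChain_getLast_head_splitBy (fun x y => decide (x < y)) π) j
    (by rw [List.flatten_splitBy]; exact hj)
  simp only [List.flatten_splitBy, decide_eq_false_iff_not] at h
  exact h

/-- Only comparisons of neighbouring entries determine the runs, so it suffices that `φ` respects
those. -/
theorem runComposition_map {φ : ℕ → ℕ} {π : List ℕ}
    (h : π.IsChain fun x y => φ x < φ y ↔ x < y) :
    (⟨_, runComposition (π.map φ)⟩ : Comp) = ⟨_, runComposition π⟩ := by
  rw [Composition.sigma_eq_iff_blocks_eq]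
  set r : ℕ → ℕ → Bool := fun x y => decide (x < y) with hr
  have hflat : (π.splitBy r).flatten = π := List.flatten_splitBy r π
  rw [← hflat, List.isChain_flatten (List.nil_notMem_splitBy r π)] at h
  have key : (π.map φ).splitBy r = (π.splitBy r).map (List.map φ) := by
    rw [List.splitBy_eq_iff]
    refine ⟨?_, ?_, ?_, ?_⟩
    · rw [← List.map_flatten, hflat]
    · simp only [List.mem_map, List.map_eq_nil_iff, not_exists, not_and]
      rintro s hs rfl
      exact List.nil_notMem_splitBy r π hs
    · simp only [List.mem_map, forall_exists_index, and_imp, forall_apply_eq_imp_iff₂]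
      intro s hs
      have h1 := List.isChain_of_mem_splitBy hs
      have h2 := h.1 s hs
      rw [List.isChain_map]
      rw [List.isChain_iff_getElem] at h1 h2 ⊢
      intro i hi
      have h3 := h1 i hi
      simp only [hr, decide_eq_true_eq] at h3 ⊢
      exact (h2 i hi).2 h3
    · rw [List.isChain_map]
      have h1 := List.isChain_getLast_head_splitBy r π
      have h2 := h.2
      rw [List.isChain_iff_getElem] at h1 h2 ⊢
      intro i hi
      obtain ⟨ha, hb, h3⟩ := h1 i hi
      refine ⟨by simpa using ha, by simpa using hb, ?_⟩
      rw [List.getLast_map, List.head_map]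
      simp only [hr, decide_eq_false_iff_not] at h3 ⊢
      rwa [h2 i hi _ (List.getLast_mem_getLast? ha) _ (List.head_mem_head? hb)]
  change ((π.map φ).splitBy r).map List.length = (π.splitBy r).map List.length
  rw [key, List.map_map]
  refine List.map_congr_left fun s _ => ?_
  simp

theorem fundamentalQ_congr {α β : Comp} (h : α = β) :
    fundamentalQ R α.2 = fundamentalQ R β.2 := by
  rw [h]

/-! ### Generating functions of labeled posets -/

theorem mem_jordanHolder {P : LabeledPoset} {π : List ℕ} :
    π ∈ P.jordanHolder ↔
      π.Nodup ∧ π.toFinset = P.labels ∧ π.Pairwise fun x y => ¬ P.lt y x := by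
  classical
  rw [LabeledPoset.jordanHolder, Finset.mem_filter, Multiset.mem_toFinset, Multiset.mem_lists_iff,
    ← and_assoc]
  refine and_congr_left fun _ => ⟨fun h => ?_, fun h => ?_⟩
  · have hn : π.Nodup := by
      have := P.labels.nodup
      rw [h] at this
      exact this
    refine ⟨hn, Finset.val_injective ?_⟩
    rw [h, List.toFinset_val, hn.dedup]
    rfl
  · rw [← h.2, List.toFinset_val, h.1.dedup]
    rfl

/-- A sequence indexed by positions is the same as a function `f` on the entries of `π`. Increase of
the key `(f x, x)` along `π` means that `f` increases weakly, and strictly where the entries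
descend. -/
theorem isCompatible_runComposition {π : List ℕ} (hπ : π.Nodup) (m : ℕ →₀ ℕ) :
    IsCompatible (runComposition π) m ↔ ∃ f : ℕ → ℕ,
      ∑ x ∈ π.toFinset, Finsupp.single (f x) 1 = m ∧
        π.Pairwise fun x y => toLex (f x, x) < toLex (f y, y) := by
  have hsum : ∀ f : ℕ → ℕ, ∑ x ∈ π.toFinset, Finsupp.single (f x) 1 =
      (∑ j : Fin π.length, Finsupp.single (f π[j]) 1 : ℕ →₀ ℕ) := by
    intro f
    rw [List.sum_toFinset _ hπ, ← Fin.sum_univ_fun_getElem]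
    rfl
  constructor
  · rintro ⟨w, hw, hm, hs⟩
    -- The value `0` off the entries of `π` is never used.
    let f : ℕ → ℕ := fun x => if h : π.idxOf x < π.length then w ⟨π.idxOf x, h⟩ else 0
    have hf : ∀ (j : ℕ) (hj : j < π.length), f π[j] = w ⟨j, hj⟩ := by
      intro j hj
      have : π.idxOf π[j] = j := hπ.idxOf_getElem j hj
      simp only [f, this, dif_pos hj]
    refine ⟨f, ?_, ?_⟩
    · rw [hsum, ← hm]
      exact Finset.sum_congr rfl fun j _ => by rw [← hf]; rfl
    · have : Trans (fun x y : ℕ => toLex (f x, x) < toLex (f y, y))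
        (fun x y : ℕ => toLex (f x, x) < toLex (f y, y))
        (fun x y : ℕ => toLex (f x, x) < toLex (f y, y)) := ⟨fun h1 h2 => h1.trans h2⟩
      rw [← List.isChain_iff_pairwise, List.isChain_iff_getElem]
      intro j hj
      rw [Prod.Lex.toLex_lt_toLex, hf, hf]
      by_cases hlt : π[j] < π[j + 1]
      · rcases lt_or_eq_of_le (hw (Fin.le_def.2 (Nat.le_succ j) :
          (⟨j, Nat.lt_of_succ_lt hj⟩ : Fin _) ≤ ⟨j + 1, hj⟩)) with h | h
        · exact Or.inl h
        · exact Or.inr ⟨h, hlt⟩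
      · exact Or.inl (hs j hj ((isPartialSum_runComposition π hj).2 hlt))
  · rintro ⟨f, hm, hp⟩
    rw [List.pairwise_iff_getElem] at hp
    refine ⟨fun j => f π[j], ?_, ?_, ?_⟩
    · intro i j hij
      rcases hij.eq_or_lt with rfl | hlt
      · rfl
      · have := hp i j i.2 j.2 hlt
        rw [Prod.Lex.toLex_lt_toLex] at this
        rcases this with h | h
        exacts [h.le, h.1.le]
    · rw [← hm, hsum]
    · intro j hj hps
      rw [isPartialSum_runComposition π hj] at hps
      have := hp j (j + 1) (by omega) hj (Nat.lt_succ_self j)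
      rw [Prod.Lex.toLex_lt_toLex] at this
      rcases this with h | h
      exacts [h, absurd h.2 hps]

open Classical in
/-- The `P`-partitions with content `m`, extended by `0` outside of `P`. -/
noncomputable def pPartitions (P : LabeledPoset) (m : ℕ →₀ ℕ) : Finset (ℕ →₀ ℕ) :=
  {f ∈ P.labels.finsupp (fun _ => insert 0 m.support) |
    ∑ x ∈ P.labels, Finsupp.single (f x) 1 = m ∧
      ∀ x y, P.lt x y → toLex (f x, x) < toLex (f y, y)}

theorem mem_pPartitions {P : LabeledPoset} {m f : ℕ →₀ ℕ} :
    f ∈ pPartitions P m ↔ f.support ⊆ P.labels ∧ ∑ x ∈ P.labels, Finsupp.single (f x) 1 = m ∧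
      ∀ x y, P.lt x y → toLex (f x, x) < toLex (f y, y) := by
  classical
  rw [pPartitions, Finset.mem_filter, Finset.mem_finsupp_iff]
  refine ⟨fun h => ⟨h.1.1, h.2⟩, fun h => ⟨⟨h.1, fun x hx => ?_⟩, h.2⟩⟩
  refine Finset.mem_insert_of_mem (Finsupp.mem_support_iff.2 ?_)
  rw [← h.2.1, Finsupp.finsetSum_apply]
  refine (Finset.sum_pos' (fun _ _ => Nat.zero_le _) ⟨x, hx, ?_⟩).ne'
  simp

theorem exists_list_pairwise_key_lt (s : Finset ℕ) (f : ℕ → ℕ) :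
    ∃ π : List ℕ, π.Nodup ∧ π.toFinset = s ∧
      π.Pairwise fun x y => toLex (f x, x) < toLex (f y, y) := by
  let key : ℕ → ℕ ×ₗ ℕ := fun x => toLex (f x, x)
  let l := (s.image key).sort (· ≤ ·)
  have hl : ∀ a ∈ l, key (ofLex a).2 = a := by
    intro a ha
    obtain ⟨x, -, rfl⟩ := Finset.mem_image.1 ((Finset.mem_sort _).1 ha)
    rfl
  have hp : (l.map fun a => (ofLex a).2).Pairwise fun x y => key x < key y := by
    rw [List.pairwise_map]
    refine ((s.image key).sortedLT_sort.pairwise).imp_of_mem fun ha hb h => ?_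
    rwa [hl _ ha, hl _ hb]
  refine ⟨l.map fun a => (ofLex a).2, ?_, ?_, hp⟩
  · exact hp.imp fun h he => by rw [he] at h; exact lt_irrefl _ h
  · ext x
    simp only [List.mem_toFinset, List.mem_map, l, Finset.mem_sort, Finset.mem_image]
    constructor
    · rintro ⟨_, ⟨y, hy, rfl⟩, rfl⟩
      exact hy
    · exact fun hx => ⟨_, ⟨x, hx, rfl⟩, rfl⟩

theorem eq_of_pairwise_key_lt {π ρ : List ℕ} (hπ : π.Nodup) (hρ : ρ.Nodup)
    (h : π.toFinset = ρ.toFinset) (f : ℕ → ℕ)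
    (h1 : π.Pairwise fun x y => toLex (f x, x) < toLex (f y, y))
    (h2 : ρ.Pairwise fun x y => toLex (f x, x) < toLex (f y, y)) : π = ρ := by
  have hperm : π.Perm ρ := (List.perm_ext_iff_of_nodup hπ hρ).2 fun x => by
    rw [← List.mem_toFinset, h, List.mem_toFinset]
  exact hperm.eq_of_pairwise (fun a b _ _ ha hb => absurd (ha.trans hb) (lt_irrefl _)) h1 h2

/-- This is Stanley's fundamental lemma on `P`-partitions. Sorting the labels by `(f x, x)` is a
bijection from the `P`-partitions with content `m` to the linear extensions whose run composition is
compatible with `m`. It is injective because `f` is weakly increasing along its own sorting, hence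
determined by that sorting and the content. -/
theorem coeff_F (P : LabeledPoset) (m : ℕ →₀ ℕ) :
    MvPowerSeries.coeff m (P.F R : MvPowerSeries ℕ R) = (pPartitions P m).card := by
  classical
  simp only [LabeledPoset.F, AddSubmonoidClass.coe_finsetSum, map_sum, coeff_fundamentalQ]
  rw [Finset.sum_boole]
  congr 1
  choose π hnd hlab hkey using fun f : ℕ →₀ ℕ => exists_list_pairwise_key_lt P.labels f
  refine (Finset.card_bij (fun f _ => π f) ?_ ?_ ?_).symm
  · intro f hf
    obtain ⟨-, hm, hlt⟩ := mem_pPartitions.1 hf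
    rw [Finset.mem_filter, mem_jordanHolder, isCompatible_runComposition (hnd f), hlab]
    refine ⟨⟨hnd f, rfl, (hkey f).imp fun h hyx => ?_⟩, f, hm, hkey f⟩
    exact lt_asymm h (hlt _ _ hyx)
  · intro f hf g hg hfg
    obtain ⟨hfs, hfm, -⟩ := mem_pPartitions.1 hf
    obtain ⟨hgs, hgm, -⟩ := mem_pPartitions.1 hg
    have hmono : ∀ h : ℕ →₀ ℕ, π h = π f → Monotone fun j : Fin (π f).length => h (π f)[j] := by
      intro h he i j hij
      have hk := hkey h
      rw [he, List.pairwise_iff_getElem] at hk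
      rcases hij.eq_or_lt with rfl | hlt
      · rfl
      · have := hk i j i.2 j.2 hlt
        rw [Prod.Lex.toLex_lt_toLex] at this
        rcases this with h | h
        exacts [h.le, h.1.le]
    have hsum : ∀ h : ℕ →₀ ℕ, ∑ x ∈ P.labels, Finsupp.single (h x) 1 =
        (∑ j : Fin (π f).length, Finsupp.single (h (π f)[j]) 1 : ℕ →₀ ℕ) := by
      intro h
      rw [← hlab f, List.sum_toFinset _ (hnd f), ← Fin.sum_univ_fun_getElem]
      rfl
    have key := eq_of_monotone_of_sum_single_eq (hmono f rfl) (hmono g hfg.symm)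
      (by rw [← hsum, ← hsum, hfm, hgm])
    ext x
    by_cases hx : x ∈ P.labels
    · rw [← hlab f, List.mem_toFinset] at hx
      obtain ⟨j, hj, rfl⟩ := List.getElem_of_mem hx
      exact congrFun key ⟨j, hj⟩
    · rw [Finsupp.notMem_support_iff.1 fun h => hx (hfs h),
        Finsupp.notMem_support_iff.1 fun h => hx (hgs h)]
  · intro ρ hρ
    rw [Finset.mem_filter, mem_jordanHolder] at hρ
    obtain ⟨⟨hρn, hρl, hρP⟩, hc⟩ := hρ
    rw [isCompatible_runComposition hρn, hρl] at hc
    obtain ⟨f, hm, hk⟩ := hc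
    -- Truncation outside the labels is needed because `pPartitions` counts functions supported on
    -- the labels.
    let g : ℕ →₀ ℕ := Finsupp.onFinset P.labels (fun x => if x ∈ P.labels then f x else 0)
      fun x hx => by
        by_contra hn
        exact hx (if_neg hn)
    have hg : ∀ x ∈ P.labels, g x = f x := fun x hx => if_pos hx
    have hmem : ∀ x ∈ ρ, x ∈ P.labels := fun x hx => hρl ▸ List.mem_toFinset.2 hx
    have hkg : ρ.Pairwise fun x y => toLex (g x, x) < toLex (g y, y) :=
      hk.imp_of_mem fun ha hb h => by rwa [hg _ (hmem _ ha), hg _ (hmem _ hb)]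
    have hlt : ∀ x y, P.lt x y → toLex (g x, x) < toLex (g y, y) := by
      intro x y hxy
      obtain ⟨hx, hy⟩ := P.mem_of_lt x y hxy
      rw [← hρl, List.mem_toFinset] at hx hy
      obtain ⟨i, hi, rfl⟩ := List.getElem_of_mem hx
      obtain ⟨j, hj, rfl⟩ := List.getElem_of_mem hy
      rcases lt_trichotomy i j with h | rfl | h
      · exact List.pairwise_iff_getElem.1 hkg i j hi hj h
      · exact absurd hxy (P.irrefl _)
      · exact absurd hxy (List.pairwise_iff_getElem.1 hρP j i hj hi h)
    refine ⟨g, mem_pPartitions.2 ⟨Finsupp.support_onFinset_subset, ?_, hlt⟩, ?_⟩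
    · rw [← hm]
      exact Finset.sum_congr rfl fun x hx => by rw [hg x hx]
    · exact eq_of_pairwise_key_lt (hnd g) hρn ((hlab g).trans hρl.symm) g (hkey g) hkg

/-- Restriction to the two label sets splits a `P`-partition of the disjoint sum into an arbitrary
pair, and contents add; this is the convolution formula for the coefficients of a product. -/
theorem F_mul_F (P Q : LabeledPoset) (h : Disjoint P.labels Q.labels) :
    P.F R * Q.F R = (disjointSum P Q h).F R := by
  classical
  refine QSym_ext fun m => ?_
  rw [coeff_F, MulMemClass.coe_mul, MvPowerSeries.coeff_mul]
  simp only [coeff_F]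
  have hPQ : ∀ x ∈ P.labels, x ∉ Q.labels := fun x hx => Finset.disjoint_left.1 h hx
  have hl : (disjointSum P Q h).labels = P.labels ∪ Q.labels := rfl
  simp only [← Nat.cast_mul, ← Nat.cast_sum, ← Finset.card_product]
  rw [← Finset.card_sigma]
  congr 1
  have hP0 : ∀ {f : ℕ →₀ ℕ}, f.support ⊆ P.labels → ∀ x ∈ Q.labels, f x = 0 := fun hf x hx =>
    Finsupp.notMem_support_iff.1 fun hn => hPQ x (hf hn) hx
  have hQ0 : ∀ {g : ℕ →₀ ℕ}, g.support ⊆ Q.labels → ∀ x ∈ P.labels, g x = 0 := fun hg x hx =>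
    Finsupp.notMem_support_iff.1 fun hn => hPQ x hx (hg hn)
  have hsplit : ∀ f : ℕ →₀ ℕ, ∑ x ∈ P.labels ∪ Q.labels, Finsupp.single (f x) 1 =
      (∑ x ∈ P.labels, Finsupp.single (f x) 1 + ∑ x ∈ Q.labels, Finsupp.single (f x) 1 : ℕ →₀ ℕ) :=
    fun f => Finset.sum_union h
  refine Finset.card_bij (fun t _ => t.2.1 + t.2.2) ?_ ?_ ?_
  · rintro ⟨p, f, g⟩ ht
    simp only [Finset.mem_sigma, Finset.mem_product, Finset.HasAntidiagonal.mem_antidiagonal,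
      mem_pPartitions] at ht
    obtain ⟨hp, ⟨hf, hfm, hfl⟩, hg, hgm, hgl⟩ := ht
    have hfx : ∀ x ∈ P.labels, (f + g) x = f x := fun x hx => by
      rw [Finsupp.add_apply, hQ0 hg x hx, add_zero]
    have hgx : ∀ x ∈ Q.labels, (f + g) x = g x := fun x hx => by
      rw [Finsupp.add_apply, hP0 hf x hx, zero_add]
    have hfs : ∑ x ∈ P.labels, Finsupp.single ((f + g) x) 1 = p.1 :=
      (Finset.sum_congr rfl fun x hx => by rw [hfx x hx]).trans hfm
    have hgs : ∑ x ∈ Q.labels, Finsupp.single ((f + g) x) 1 = p.2 :=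
      (Finset.sum_congr rfl fun x hx => by rw [hgx x hx]).trans hgm
    rw [mem_pPartitions, hl, hsplit]
    refine ⟨Finsupp.support_add.trans (Finset.union_subset_union hf hg), ?_, ?_⟩
    · rw [hfs, hgs, hp]
    · rintro x y (hxy | hxy)
      · rw [hfx x (P.mem_of_lt x y hxy).1, hfx y (P.mem_of_lt x y hxy).2]
        exact hfl x y hxy
      · rw [hgx x (Q.mem_of_lt x y hxy).1, hgx y (Q.mem_of_lt x y hxy).2]
        exact hgl x y hxy
  · rintro ⟨⟨p, q⟩, f, g⟩ ht ⟨⟨p', q'⟩, f', g'⟩ ht' he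
    simp only [Finset.mem_sigma, Finset.mem_product, Finset.HasAntidiagonal.mem_antidiagonal,
      mem_pPartitions] at ht ht' he
    obtain ⟨-, ⟨hf, rfl, -⟩, hg, rfl, -⟩ := ht
    obtain ⟨-, ⟨hf', rfl, -⟩, hg', rfl, -⟩ := ht'
    have hff : f = f' := by
      ext x
      by_cases hx : x ∈ P.labels
      · have := DFunLike.congr_fun he x
        rwa [Finsupp.add_apply, Finsupp.add_apply, hQ0 hg x hx, hQ0 hg' x hx] at this
      · rw [Finsupp.notMem_support_iff.1 fun h => hx (hf h),
          Finsupp.notMem_support_iff.1 fun h => hx (hf' h)]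
    subst hff
    rw [add_left_cancel he]
  · intro f hf
    rw [mem_pPartitions, hl, hsplit] at hf
    obtain ⟨hf, hm, hlt⟩ := hf
    have hfx : ∀ x ∈ P.labels, f.filter (· ∈ P.labels) x = f x := fun x hx =>
      Finsupp.filter_apply_pos _ _ hx
    have hgx : ∀ x ∈ Q.labels, f.filter (· ∈ Q.labels) x = f x := fun x hx =>
      Finsupp.filter_apply_pos _ _ hx
    refine ⟨⟨(∑ x ∈ P.labels, Finsupp.single (f x) 1, ∑ x ∈ Q.labels, Finsupp.single (f x) 1),
      f.filter (· ∈ P.labels), f.filter (· ∈ Q.labels)⟩, ?_, ?_⟩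
    · simp only [Finset.mem_sigma, Finset.mem_product, Finset.HasAntidiagonal.mem_antidiagonal,
        mem_pPartitions]
      refine ⟨hm, ⟨fun x hx => ?_, ?_, fun x y hxy => ?_⟩, fun x hx => ?_, ?_, fun x y hxy => ?_⟩
      · rw [Finsupp.support_filter] at hx
        exact (Finset.mem_filter.1 hx).2
      · exact Finset.sum_congr rfl fun x hx => by rw [hfx x hx]
      · rw [hfx x (P.mem_of_lt x y hxy).1, hfx y (P.mem_of_lt x y hxy).2]
        exact hlt x y (Or.inl hxy)
      · rw [Finsupp.support_filter] at hx
        exact (Finset.mem_filter.1 hx).2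
      · exact Finset.sum_congr rfl fun x hx => by rw [hgx x hx]
      · rw [hgx x (Q.mem_of_lt x y hxy).1, hgx y (Q.mem_of_lt x y hxy).2]
        exact hlt x y (Or.inr hxy)
    · ext x
      simp only [Finsupp.add_apply, Finsupp.filter_apply]
      by_cases hx : x ∈ P.labels
      · simp [hx, hPQ x hx]
      · by_cases hx' : x ∈ Q.labels
        · simp [hx, hx']
        · simp only [hx, hx', if_false]
          refine (Finsupp.notMem_support_iff.1 fun hn => ?_).symm
          exact (Finset.mem_union.1 (hf hn)).elim hx hx'

/-! ### Linear extensions of ordinal sums -/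

/-- `x` lies in an earlier set of `K` than `y`. -/
def BlockLt (K : List (Finset ℕ)) (x y : ℕ) : Prop :=
  ∃ i j : Fin K.length, i < j ∧ x ∈ K.get i ∧ y ∈ K.get j

/-- `S` arranges the elements of each set of `K` in some order. -/
def Arranges (S : List (List ℕ)) (K : List (Finset ℕ)) : Prop :=
  List.Forall₂ (fun (σ : List ℕ) (B : Finset ℕ) => σ.Nodup ∧ σ.toFinset = B) S K

theorem blockLt_cons {B : Finset ℕ} {K : List (Finset ℕ)} {x y : ℕ} :
    BlockLt (B :: K) x y ↔ (x ∈ B ∧ ∃ C ∈ K, y ∈ C) ∨ BlockLt K x y := by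
  constructor
  · rintro ⟨i, j, hij, hx, hy⟩
    induction j using Fin.cases with
    | zero => exact absurd hij (Fin.not_lt_zero i)
    | succ j =>
      induction i using Fin.cases with
      | zero => exact Or.inl ⟨hx, _, List.get_mem K j, hy⟩
      | succ i => exact Or.inr ⟨i, j, Fin.succ_lt_succ_iff.1 hij, hx, hy⟩
  · rintro (⟨hx, C, hC, hy⟩ | ⟨i, j, hij, hx, hy⟩)
    · obtain ⟨j, rfl⟩ := List.mem_iff_get.1 hC
      exact ⟨⟨0, Nat.succ_pos _⟩, j.succ, Fin.succ_pos j, hx, hy⟩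
    · exact ⟨i.succ, j.succ, Fin.succ_lt_succ_iff.2 hij, hx, hy⟩

theorem BlockLt.exists_mem {K : List (Finset ℕ)} {x y : ℕ} (h : BlockLt K x y) :
    (∃ B ∈ K, x ∈ B) ∧ ∃ B ∈ K, y ∈ B := by
  obtain ⟨i, j, -, hx, hy⟩ := h
  exact ⟨⟨_, List.get_mem K i, hx⟩, _, List.get_mem K j, hy⟩

theorem filter_append_filter_not {p : ℕ → Prop} [DecidablePred p] : ∀ {l : List ℕ},
    l.Pairwise (fun x y => p y → p x) → l.filter (fun x => p x) ++ l.filter (fun x => ¬ p x) = l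
  | [], _ => rfl
  | a :: l, h => by
    rw [List.pairwise_cons] at h
    by_cases ha : p a
    · simpa [ha] using filter_append_filter_not h.2
    · have h1 : ∀ x ∈ l, ¬ p x := fun x hx hpx => ha (h.1 x hx hpx)
      have h2 : l.filter (fun x => p x) = [] := by simpa using h1
      have h3 : l.filter (fun x => ¬ p x) = l := by simpa using h1
      simp only [decide_not] at h3 ⊢
      simp [ha, h2, h3]

/-- No element of the first set may follow one of a later set, so filtering by membership in it cuts
`π` in two without reordering; recurse on the rest. -/
theorem exists_arranges : ∀ {K : List (Finset ℕ)} {π : List ℕ}, K.Pairwise Disjoint →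
    π.Nodup → (∀ x, x ∈ π ↔ ∃ B ∈ K, x ∈ B) → (π.Pairwise fun x y => ¬ BlockLt K y x) →
    ∃ S, Arranges S K ∧ S.flatten = π
  | [], π, _, _, hmem, _ => by
    have : π = [] := List.eq_nil_iff_forall_not_mem.2 fun x hx => by simpa using (hmem x).1 hx
    exact ⟨[], List.Forall₂.nil, this.symm⟩
  | B :: K, π, hK, hnd, hmem, hp => by
    rw [List.pairwise_cons] at hK
    have hB : ∀ x, (∃ C ∈ K, x ∈ C) → x ∉ B := fun x ⟨C, hC, hx⟩ hxB =>
      Finset.disjoint_left.1 (hK.1 C hC) hxB hx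
    have hsplit : π.filter (fun x => x ∈ B) ++ π.filter (fun x => ¬ x ∈ B) = π := by
      refine filter_append_filter_not (hp.imp_of_mem fun {x y} hx hy h hyB => ?_)
      by_contra hxB
      refine h (blockLt_cons.2 (Or.inl ⟨hyB, ?_⟩))
      obtain ⟨C, hC, hxC⟩ := (hmem x).1 hx
      rcases List.mem_cons.1 hC with rfl | hC
      · exact absurd hxC hxB
      · exact ⟨C, hC, hxC⟩
    obtain ⟨S, hS, hSf⟩ := exists_arranges (π := π.filter fun x => ¬ x ∈ B) hK.2
      (hnd.filter _) (fun x => by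
        simp only [List.mem_filter, hmem, List.mem_cons, exists_eq_or_imp, decide_eq_true_eq]
        exact ⟨fun h => h.1.resolve_left h.2, fun h => ⟨Or.inr h, hB x h⟩⟩)
      ((hp.filter _).imp fun h h' => h (blockLt_cons.2 (Or.inr h')))
    refine ⟨π.filter (fun x => x ∈ B) :: S, List.Forall₂.cons ⟨hnd.filter _, ?_⟩ hS, ?_⟩
    · ext x
      simp only [List.mem_toFinset, List.mem_filter, hmem, decide_eq_true_eq]
      exact ⟨fun h => h.2, fun h => ⟨⟨B, List.mem_cons_self, h⟩, h⟩⟩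
    · rw [List.flatten_cons, hSf, hsplit]

theorem Arranges.mem_flatten_iff {S : List (List ℕ)} {K : List (Finset ℕ)} (h : Arranges S K)
    (x : ℕ) : x ∈ S.flatten ↔ ∃ B ∈ K, x ∈ B := by
  unfold Arranges at h
  induction h with
  | nil => simp
  | cons h _ ih =>
    rw [List.flatten_cons, List.mem_append, ih, ← List.mem_toFinset, h.2]
    simp

theorem Arranges.nodup_flatten {S : List (List ℕ)} {K : List (Finset ℕ)} (h : Arranges S K)
    (hK : K.Pairwise Disjoint) : S.flatten.Nodup := by
  unfold Arranges at h
  induction h with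
  | nil => simp
  | @cons σ B S K h hS ih =>
    rw [List.pairwise_cons] at hK
    rw [List.flatten_cons, List.nodup_append']
    refine ⟨h.1, ih hK.2, fun x hx hx' => ?_⟩
    obtain ⟨C, hC, hxC⟩ := (Arranges.mem_flatten_iff hS x).1 hx'
    rw [← List.mem_toFinset, h.2] at hx
    exact Finset.disjoint_left.1 (hK.1 C hC) hx hxC

theorem Arranges.pairwise_flatten {S : List (List ℕ)} {K : List (Finset ℕ)} (h : Arranges S K)
    (hK : K.Pairwise Disjoint) : S.flatten.Pairwise fun x y => ¬ BlockLt K y x := by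
  unfold Arranges at h
  induction h with
  | nil => simp
  | @cons σ B S K h hS ih =>
    rw [List.pairwise_cons] at hK
    have hB : ∀ x, (∃ C ∈ K, x ∈ C) → x ∉ B := fun x ⟨C, hC, hx⟩ hxB =>
      Finset.disjoint_left.1 (hK.1 C hC) hxB hx
    have hσ : ∀ x ∈ σ, x ∈ B := fun x hx => by rwa [← List.mem_toFinset, h.2] at hx
    rw [List.flatten_cons, List.pairwise_append]
    refine ⟨List.pairwise_of_forall_mem_list fun x hx y _ hlt => ?_,
      (ih hK.2).imp_of_mem fun {x y} _ hy hn hlt => ?_, fun x hx y _ hlt => ?_⟩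
    · rcases blockLt_cons.1 hlt with ⟨-, h1⟩ | h1
      · exact hB x h1 (hσ x hx)
      · exact hB x h1.exists_mem.2 (hσ x hx)
    · rcases blockLt_cons.1 hlt with ⟨h1, -⟩ | h1
      · exact hB y ((Arranges.mem_flatten_iff hS y).1 hy) h1
      · exact hn h1
    · rcases blockLt_cons.1 hlt with ⟨-, h1⟩ | h1
      · exact hB x h1 (hσ x hx)
      · exact hB x h1.exists_mem.2 (hσ x hx)

theorem mem_labels_ordinalSum {K : List (Finset ℕ)} {hK : K.Pairwise Disjoint}
    {hpos : ∀ B ∈ K, ∀ x ∈ B, 0 < x} {x : ℕ} :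
    x ∈ (ordinalSum K hK hpos).labels ↔ ∃ B ∈ K, x ∈ B := by
  simp only [ordinalSum, Finset.mem_biUnion, Finset.mem_univ, true_and]
  constructor
  · rintro ⟨i, hi⟩
    exact ⟨_, List.get_mem K i, hi⟩
  · rintro ⟨B, hB, hx⟩
    obtain ⟨i, rfl⟩ := List.mem_iff_get.1 hB
    exact ⟨i, hx⟩

theorem mem_jordanHolder_ordinalSum {K : List (Finset ℕ)} {hK : K.Pairwise Disjoint}
    {hpos : ∀ B ∈ K, ∀ x ∈ B, 0 < x} {π : List ℕ} :
    π ∈ (ordinalSum K hK hpos).jordanHolder ↔ ∃ S, Arranges S K ∧ S.flatten = π := by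
  rw [mem_jordanHolder]
  constructor
  · rintro ⟨hnd, hlab, hp⟩
    refine exists_arranges hK hnd (fun x => ?_) hp
    rw [← List.mem_toFinset, hlab, mem_labels_ordinalSum]
  · rintro ⟨S, hS, rfl⟩
    refine ⟨hS.nodup_flatten hK, ?_, hS.pairwise_flatten hK⟩
    ext x
    rw [List.mem_toFinset, hS.mem_flatten_iff, mem_labels_ordinalSum]

/-! ### Relabeling alternating ordinal sums -/

theorem exists_strictMonoOn_image_eq {A B : Finset ℕ} (h : A.card = B.card) :
    ∃ φ : ℕ → ℕ, StrictMonoOn φ A ∧ A.image φ = B := by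
  let e := (A.orderIsoOfFin rfl).symm.trans (B.orderIsoOfFin h.symm)
  refine ⟨fun x => if hx : x ∈ A then e ⟨x, hx⟩ else 0, fun x hx y hy hxy => ?_, ?_⟩
  · rw [Finset.mem_coe] at hx hy
    simp only [hx, hy, dif_pos]
    exact e.strictMono (show (⟨x, hx⟩ : A) < ⟨y, hy⟩ from hxy)
  · ext y
    rw [Finset.mem_image]
    constructor
    · rintro ⟨x, hx, rfl⟩
      simp only [hx, dif_pos]
      exact (e _).2
    · intro hy
      refine ⟨e.symm ⟨y, hy⟩, (e.symm ⟨y, hy⟩).2, ?_⟩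
      simp

/-- Increasing bijections of the individual blocks glue to one function by disjointness. -/
theorem exists_relabeling : ∀ {K K' : List (Finset ℕ)}, K.Pairwise Disjoint →
    K.map Finset.card = K'.map Finset.card →
    ∃ φ : ℕ → ℕ, List.Forall₂ (fun A A' : Finset ℕ => StrictMonoOn φ A ∧ A.image φ = A') K K'
  | [], [], _, _ => ⟨id, List.Forall₂.nil⟩
  | [], _ :: _, _, h => by simp at h
  | _ :: _, [], _, h => by simp at h
  | A :: K, A' :: K', hK, h => by
    rw [List.pairwise_cons] at hK
    simp only [List.map_cons, List.cons.injEq] at h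
    obtain ⟨φ, hφ⟩ := exists_relabeling hK.2 h.2
    obtain ⟨χ, hχ, hχA⟩ := exists_strictMonoOn_image_eq h.1
    have h1 : ∀ x ∈ A, (if x ∈ A then χ x else φ x) = χ x := fun x hx => if_pos hx
    refine ⟨fun x => if x ∈ A then χ x else φ x, List.Forall₂.cons ⟨fun x hx y hy hxy => ?_, ?_⟩ ?_⟩
    · rw [Finset.mem_coe] at hx hy
      simp only [h1 x hx, h1 y hy]
      exact hχ hx hy hxy
    · rw [← hχA]
      exact Finset.image_congr h1
    · rw [List.forall₂_iff_get] at hφ ⊢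
      refine ⟨hφ.1, fun i hi hi' => ?_⟩
      obtain ⟨hm, he⟩ := hφ.2 i hi hi'
      have h2 : ∀ x ∈ K.get ⟨i, hi⟩, (if x ∈ A then χ x else φ x) = φ x := fun x hx =>
        if_neg fun hxA => Finset.disjoint_left.1 (hK.1 _ (List.get_mem K _)) hxA hx
      refine ⟨fun x hx y hy hxy => ?_, ?_⟩
      · rw [Finset.mem_coe] at hx hy
        simp only [h2 x hx, h2 y hy]
        exact hm hx hy hxy
      · rw [← he]
        exact Finset.image_congr h2

theorem Arranges.get {S : List (List ℕ)} {K : List (Finset ℕ)} (h : Arranges S K) {i : ℕ}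
    (hi : i < S.length) (hi' : i < K.length) : S[i].Nodup ∧ S[i].toFinset = K[i] :=
  (List.forall₂_iff_get.1 h).2 i hi hi'

theorem Arranges.nil_notMem {S : List (List ℕ)} {K : List (Finset ℕ)} (h : Arranges S K)
    (hne : ∀ B ∈ K, B.Nonempty) : [] ∉ S := by
  intro hm
  obtain ⟨i, hi, he⟩ := List.getElem_of_mem hm
  have hi' : i < K.length := h.length_eq ▸ hi
  have := (h.get hi hi').2
  rw [he] at this
  exact (hne _ (List.getElem_mem hi')).ne_empty this.symm

theorem Arranges.map {S : List (List ℕ)} {K K' : List (Finset ℕ)} {φ : ℕ → ℕ} (h : Arranges S K)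
    (hφ : List.Forall₂ (fun A A' : Finset ℕ => Set.InjOn φ A ∧ A.image φ = A') K K') :
    Arranges (S.map (List.map φ)) K' := by
  unfold Arranges at *
  rw [List.forall₂_map_left_iff]
  induction h generalizing K' with
  | nil => cases hφ; exact List.Forall₂.nil
  | @cons σ B S K h _ ih =>
    cases hφ with
    | cons h' hr =>
      refine List.Forall₂.cons ⟨?_, ?_⟩ (ih hr)
      · refine h.1.map_on fun x hx y hy hxy => h'.1 ?_ ?_ hxy
        · rwa [← List.mem_toFinset, h.2] at hx
        · rwa [← List.mem_toFinset, h.2] at hy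
      · rw [← h'.2, ← h.2]
        ext x
        simp

/-- A relabeling that increases on each block carries linear extensions to linear extensions. It
preserves their runs as well: inside a block by monotonicity, at a joint because both labelings
alternate in the same direction. -/
theorem F_ordinalSum_congr {K K' : List (Finset ℕ)} (hK : K.Pairwise Disjoint)
    (hpos : ∀ B ∈ K, ∀ x ∈ B, 0 < x) (hK' : K'.Pairwise Disjoint)
    (hpos' : ∀ B ∈ K', ∀ x ∈ B, 0 < x) (hne : ∀ B ∈ K, B.Nonempty)
    (hcard : K.map Finset.card = K'.map Finset.card) (halt : IsAlternating K)
    (halt' : IsAlternating K') :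
    (ordinalSum K hK hpos).F R = (ordinalSum K' hK' hpos').F R := by
  obtain ⟨φ, hφ⟩ := exists_relabeling hK hcard
  have hlen : K.length = K'.length := hφ.length_eq
  have hget : ∀ (i : ℕ) (hi : i < K.length) (hi' : i < K'.length),
      StrictMonoOn φ K[i] ∧ K[i].image φ = K'[i] := fun i hi hi' =>
    (List.forall₂_iff_get.1 hφ).2 i hi hi'
  have hmem : ∀ (i : ℕ) (hi : i < K.length) (hi' : i < K'.length), ∀ x ∈ K[i], φ x ∈ K'[i] := by
    intro i hi hi' x hx
    rw [← (hget i hi hi').2]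
    exact Finset.mem_image_of_mem _ hx
  have hinj : Set.InjOn φ {x | ∃ B ∈ K, x ∈ B} := by
    rintro x ⟨B, hB, hx⟩ y ⟨C, hC, hy⟩ hxy
    obtain ⟨i, hi, rfl⟩ := List.getElem_of_mem hB
    obtain ⟨j, hj, rfl⟩ := List.getElem_of_mem hC
    have h1 := hmem i hi (hlen ▸ hi) x hx
    have h2 := hmem j hj (hlen ▸ hj) y hy
    rw [hxy] at h1
    have hij : i = j := by
      by_contra hne
      rcases lt_or_gt_of_ne hne with h | h
      · exact Finset.disjoint_left.1 (List.pairwise_iff_getElem.1 hK' _ _ _ _ h) h1 h2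
      · exact Finset.disjoint_left.1 (List.pairwise_iff_getElem.1 hK' _ _ _ _ h) h2 h1
    subst hij
    exact (hget i hi (hlen ▸ hi)).1.injOn hx hy hxy
  obtain ⟨ψ, hψ⟩ : ∃ ψ : ℕ → ℕ, ∀ x, (∃ B ∈ K, x ∈ B) → ψ (φ x) = x :=
    ⟨Function.invFunOn φ {x | ∃ B ∈ K, x ∈ B}, fun x hx => hinj.leftInvOn_invFunOn hx⟩
  have hφ1 : List.Forall₂ (fun A A' : Finset ℕ => Set.InjOn φ A ∧ A.image φ = A') K K' :=
    hφ.imp fun A A' h => ⟨h.1.injOn, h.2⟩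
  have hψ1 : List.Forall₂ (fun A A' : Finset ℕ => Set.InjOn ψ A ∧ A.image ψ = A') K' K := by
    rw [List.forall₂_iff_get]
    refine ⟨hlen.symm, fun i hi' hi => ?_⟩
    have h1 := (hget i hi hi').2
    have h2 : ∀ x ∈ K[i], ψ (φ x) = x := fun x hx => hψ x ⟨_, List.getElem_mem hi, hx⟩
    simp only [List.get_eq_getElem, ← h1]
    refine ⟨?_, ?_⟩
    · intro x hx y hy hxy
      obtain ⟨x', hx', rfl⟩ := Finset.mem_image.1 (Finset.mem_coe.1 hx)
      obtain ⟨y', hy', rfl⟩ := Finset.mem_image.1 (Finset.mem_coe.1 hy)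
      rw [h2 x' hx', h2 y' hy'] at hxy
      rw [hxy]
    · rw [Finset.image_image]
      exact (Finset.image_congr h2).trans Finset.image_id
  have hφψ : ∀ y, (∃ B ∈ K', y ∈ B) → φ (ψ y) = y := by
    rintro y ⟨B, hB, hy⟩
    obtain ⟨i, hi', rfl⟩ := List.getElem_of_mem hB
    have hi : i < K.length := hlen ▸ hi'
    rw [← (hget i hi hi').2] at hy
    obtain ⟨x, hx, rfl⟩ := Finset.mem_image.1 hy
    rw [hψ x ⟨_, List.getElem_mem hi, hx⟩]
  unfold LabeledPoset.F
  refine Finset.sum_bij' (fun π _ => π.map φ) (fun π _ => π.map ψ) ?_ ?_ ?_ ?_ ?_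
  · intro π hπ
    obtain ⟨S, hS, rfl⟩ := mem_jordanHolder_ordinalSum.1 hπ
    exact mem_jordanHolder_ordinalSum.2 ⟨_, hS.map hφ1, by rw [List.map_flatten]⟩
  · intro π hπ
    obtain ⟨S, hS, rfl⟩ := mem_jordanHolder_ordinalSum.1 hπ
    exact mem_jordanHolder_ordinalSum.2 ⟨_, hS.map hψ1, by rw [List.map_flatten]⟩
  · intro π hπ
    obtain ⟨S, hS, rfl⟩ := mem_jordanHolder_ordinalSum.1 hπ
    rw [List.map_map]
    exact (List.map_congr_left fun x hx => hψ x ((hS.mem_flatten_iff x).1 hx)).trans (List.map_id _)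
  · intro π hπ
    obtain ⟨S, hS, rfl⟩ := mem_jordanHolder_ordinalSum.1 hπ
    rw [List.map_map]
    exact (List.map_congr_left fun x hx => hφψ x ((hS.mem_flatten_iff x).1 hx)).trans (List.map_id _)
  · intro π hπ
    obtain ⟨S, hS, rfl⟩ := mem_jordanHolder_ordinalSum.1 hπ
    refine (fundamentalQ_congr (runComposition_map ?_)).symm
    have hin : ∀ (i : ℕ) (hi : i < S.length) (hi' : i < K.length), ∀ x ∈ S[i], x ∈ K[i] := by
      intro i hi hi' x hx
      rwa [← List.mem_toFinset, (hS.get hi hi').2] at hx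
    -- Nonempty blocks ensure that neighbouring entries lie in one block or in two consecutive ones;
    -- alternation says nothing about blocks further apart.
    rw [List.isChain_flatten (hS.nil_notMem hne)]
    refine ⟨fun σ hσ => ?_, ?_⟩
    · obtain ⟨i, hi, rfl⟩ := List.getElem_of_mem hσ
      have hi' : i < K.length := hS.length_eq ▸ hi
      rw [List.isChain_iff_getElem]
      intro j hj
      exact (hget i hi' (hlen ▸ hi')).1.lt_iff_lt (hin i hi hi' _ (List.getElem_mem _))
        (hin i hi hi' _ (List.getElem_mem _))
    · rw [List.isChain_iff_getElem]
      intro i hi x hx y hy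
      have hi' : i + 1 < K.length := hS.length_eq ▸ hi
      have hx' := hin i (by omega) (by omega) x (List.mem_of_getLast? hx)
      have hy' := hin (i + 1) hi hi' y (List.mem_of_head? hy)
      have h1 := halt i hi' x hx' y hy'
      have h2 := halt' i (hlen ▸ hi') _ (hmem i (by omega) (by omega) x hx') _
        (hmem (i + 1) hi' (hlen ▸ hi') y hy')
      split_ifs at h1 h2
      · exact iff_of_false h2.not_gt h1.not_gt
      · exact iff_of_true h2 h1

/-! ### Alternating blocks -/

theorem map_card_altBlocks : ∀ (l : List ℕ) (o e : ℕ), (altBlocks o e l).map Finset.card = l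
  | [], _, _ => rfl
  | a :: l, o, e => by
    simp [altBlocks, map_card_altBlocks l]

theorem nonempty_of_mem_altBlocks {l : List ℕ} {o e : ℕ} (hl : ∀ a ∈ l, 0 < a) :
    ∀ B ∈ altBlocks o e l, B.Nonempty := by
  intro B hB
  rw [← Finset.card_pos]
  refine hl _ ?_
  rw [← map_card_altBlocks l o e]
  exact List.mem_map_of_mem hB

theorem mem_getElem_altBlocks : ∀ (l : List ℕ) (o e i : ℕ) (hi : i < (altBlocks o e l).length),
    ∀ x ∈ (altBlocks o e l)[i],
      if Even i then o < x ∧ x ≤ o + oddSum l else e < x ∧ x ≤ e + evenSum l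
  | [], _, _, i, hi, _, _ => by simp [altBlocks] at hi
  | a :: l, o, e, 0, _, x, hx => by
    simp only [altBlocks, List.getElem_cons_zero, Finset.mem_Ioc] at hx
    rw [oddSum_cons]
    simp only [Even.zero, if_true]
    omega
  | a :: l, o, e, i + 1, hi, x, hx => by
    simp only [altBlocks, List.getElem_cons_succ] at hx
    have := mem_getElem_altBlocks l e (o + a) i _ x hx
    have h1 : evenSum (a :: l) = oddSum l := rfl
    rw [oddSum_cons, h1]
    simp only [Nat.even_add_one]
    split_ifs at this ⊢ with h
    all_goals omega

/-- The labels in the sets in odd position (the first, the third, …) are those exceeding `c`. -/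
def IsThreshold (c : ℕ) (K : List (Finset ℕ)) : Prop :=
  ∀ (i : ℕ) (hi : i < K.length), ∀ x ∈ K[i], (c < x ↔ Even i)

theorem isThreshold_altBlocks {o e c : ℕ} {l : List ℕ} (ho : c ≤ o) (he : e + evenSum l ≤ c) :
    IsThreshold c (altBlocks o e l) := by
  intro i hi x hx
  have := mem_getElem_altBlocks l o e i hi x hx
  split_ifs at this with h
  · simp only [h, iff_true]
    omega
  · simp only [h, iff_false]
    omega

theorem IsThreshold.isAlternating {c : ℕ} {K : List (Finset ℕ)} (h : IsThreshold c K) :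
    IsAlternating K := by
  intro i hi x hx y hy
  have h1 := h i (by omega) x hx
  have h2 := h (i + 1) hi y hy
  rw [Nat.even_add_one] at h2
  split_ifs with hi'
  · have := h1.2 hi'
    have := mt h2.1 (not_not.2 hi')
    omega
  · have := mt h1.1 hi'
    have := h2.2 hi'
    omega

/-- The composition with the same positive entries as `l`. -/
def toComp (l : List ℕ) : Comp :=
  ⟨_, l.filter (0 < ·), fun hi => by simpa using (List.mem_filter.1 hi).2, rfl⟩

theorem toComp_blocks {l : List ℕ} (hl : ∀ a ∈ l, 0 < a) : (toComp l).2.blocks = l :=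
  List.filter_eq_self.2 fun a ha => by simpa using hl a ha

theorem F_ordinalSum_eq_N {K : List (Finset ℕ)} (hK : K.Pairwise Disjoint)
    (hpos : ∀ B ∈ K, ∀ x ∈ B, 0 < x) (hne : ∀ B ∈ K, B.Nonempty) (halt : IsAlternating K)
    {n : ℕ} {α : Composition n} (hα : K.map Finset.card = α.blocks) :
    (ordinalSum K hK hpos).F R = N R α := by
  unfold N posetP altPoset
  refine F_ordinalSum_congr hK hpos _ _ hne ?_ halt ?_
  · rw [hα, map_card_altBlocks]
  · exact (isThreshold_altBlocks le_rfl (Nat.zero_add _).le).isAlternating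

theorem F_altPoset {n : ℕ} (α : Composition n) {o e : ℕ} (h : e + evenSum α.blocks ≤ o) :
    (altPoset o e α.blocks h).F R = N R α :=
  F_ordinalSum_eq_N _ _ (nonempty_of_mem_altBlocks fun _ => α.blocks_pos)
    (isThreshold_altBlocks le_rfl h).isAlternating (map_card_altBlocks _ _ _)

/-! ### Segments of constant position -/

theorem splitBy_congr {r r' : ℕ → ℕ → Bool} {l : List ℕ}
    (h : ∀ x ∈ l, ∀ y ∈ l, r x y = r' x y) : l.splitBy r = l.splitBy r' := by
  have hm : ∀ s ∈ l.splitBy r', ∀ x ∈ s, x ∈ l := fun s hs x hx => by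
    rw [← List.flatten_splitBy r' l]
    exact List.mem_flatten_of_mem hs hx
  rw [List.splitBy_eq_iff]
  refine ⟨(List.flatten_splitBy r' l).symm, List.nil_notMem_splitBy r' l, fun s hs => ?_, ?_⟩
  · have h1 := List.isChain_of_mem_splitBy hs
    rw [List.isChain_iff_getElem] at h1 ⊢
    intro i hi
    rw [h _ (hm s hs _ (List.getElem_mem _)) _ (hm s hs _ (List.getElem_mem _))]
    exact h1 i hi
  · have h1 := List.isChain_getLast_head_splitBy r' l
    rw [List.isChain_iff_getElem] at h1 ⊢
    intro i hi
    obtain ⟨ha, hb, h2⟩ := h1 i hi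
    refine ⟨ha, hb, ?_⟩
    rwa [h _ (hm _ (List.getElem_mem _) _ (List.getLast_mem ha)) _
      (hm _ (List.getElem_mem _) _ (List.head_mem hb))]

/-- The maximal segments of `π` on which `c < x` is constant. -/
def segments (c : ℕ) (π : List ℕ) : List (List ℕ) :=
  π.splitBy fun x y => decide (c < x ↔ c < y)

theorem flatten_segments (c : ℕ) (π : List ℕ) : (segments c π).flatten = π :=
  List.flatten_splitBy _ _

theorem ne_nil_of_mem_segments {c : ℕ} {π s : List ℕ} (hs : s ∈ segments c π) : s ≠ [] :=
  List.ne_nil_of_mem_splitBy hs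

theorem lt_iff_lt_of_mem_segments {c : ℕ} {π s : List ℕ} (hs : s ∈ segments c π) {x y : ℕ}
    (hx : x ∈ s) (hy : y ∈ s) : c < x ↔ c < y := by
  have h1 : s.IsChain fun x y => (c < x ↔ c < y) :=
    (List.isChain_of_mem_splitBy hs).imp fun x y h => by simpa using h
  have : Trans (fun x y => (c < x ↔ c < y)) (fun x y => (c < x ↔ c < y))
    (fun x y : ℕ => (c < x ↔ c < y)) := ⟨fun h1 h2 => h1.trans h2⟩
  rw [List.isChain_iff_pairwise, List.pairwise_iff_getElem] at h1
  obtain ⟨i, hi, rfl⟩ := List.getElem_of_mem hx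
  obtain ⟨j, hj, rfl⟩ := List.getElem_of_mem hy
  rcases lt_trichotomy i j with h | rfl | h
  · exact h1 i j hi hj h
  · rfl
  · exact (h1 j i hj hi h).symm

/-- The first segment lies above `c` with its first entry, and the side changes at each cut. -/
theorem lt_iff_even_of_mem_segments {c : ℕ} {π : List ℕ} (hπ : ∀ x ∈ π.head?, c < x) :
    ∀ (i : ℕ) (hi : i < (segments c π).length), ∀ x ∈ (segments c π)[i], (c < x ↔ Even i) := by
  intro i
  induction i with
  | zero =>
    intro hi x hx
    have h0 : π ≠ [] := by
      rintro rfl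
      simp [segments] at hi
    have h1 : (segments c π)[0] ≠ [] := ne_nil_of_mem_segments (List.getElem_mem hi)
    have h2 : (segments c π)[0].head h1 = π.head h0 := by
      have := List.head_head_splitBy (fun x y => decide (c < x ↔ c < y)) h0
      rw [← this]
      simp only [List.head_eq_getElem]
      rfl
    rw [lt_iff_lt_of_mem_segments (List.getElem_mem hi) hx (List.head_mem h1), h2]
    simpa using hπ _ (List.head_mem_head? h0)
  | succ i ih =>
    intro hi x hx
    have h1 := List.isChain_getLast_head_splitBy (fun x y => decide (c < x ↔ c < y)) π
    rw [List.isChain_iff_getElem] at h1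
    obtain ⟨ha, hb, h2⟩ := h1 i hi
    have h3 := ih (by omega) _ (List.getLast_mem ha)
    rw [lt_iff_lt_of_mem_segments (List.getElem_mem hi) hx (List.head_mem hb)]
    rw [decide_eq_false_iff_not] at h2
    rw [Nat.even_add_one, ← h3]
    tauto

/-- Both halves are proved together because removing the first segment interchanges odd and even
positions. -/
theorem oddSum_map_length_and {c : ℕ} : ∀ S : List (List ℕ),
    ((∀ (i : ℕ) (hi : i < S.length), ∀ x ∈ S[i], (c < x ↔ Even i)) →
      oddSum (S.map List.length) = S.flatten.countP (c < ·)) ∧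
    ((∀ (i : ℕ) (hi : i < S.length), ∀ x ∈ S[i], (c < x ↔ ¬ Even i)) →
      evenSum (S.map List.length) = S.flatten.countP (c < ·))
  | [] => ⟨fun _ => rfl, fun _ => rfl⟩
  | s :: S => by
    constructor
    · intro h
      have h1 : ∀ x ∈ s, c < x := fun x hx => (h 0 (Nat.succ_pos _) x hx).2 Even.zero
      rw [List.map_cons, oddSum_cons, (oddSum_map_length_and S).2 fun i hi x hx => by
        rw [h (i + 1) (Nat.succ_lt_succ hi) x hx, Nat.even_add_one], List.flatten_cons,
        List.countP_append, (List.countP_eq_length (l := s)).2 fun x hx => by simpa using h1 x hx]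
    · intro h
      have h1 : ∀ x ∈ s, ¬ c < x := fun x hx h' =>
        (h 0 (Nat.succ_pos _) x hx).1 h' Even.zero
      rw [List.map_cons, show evenSum (s.length :: S.map List.length) =
        oddSum (S.map List.length) from rfl, (oddSum_map_length_and S).1 fun i hi x hx => by
        rw [h (i + 1) (Nat.succ_lt_succ hi) x hx, Nat.even_add_one, not_not], List.flatten_cons,
        List.countP_append, (List.countP_eq_zero (l := s)).2 fun x hx => by simpa using h1 x hx,
        zero_add]

/-- The rank of the type becomes a count of labels above `c`, a quantity that does not see how the
labels are grouped. -/
theorem IsThreshold.oddSum_map_card {c : ℕ} {K : List (Finset ℕ)} (h : IsThreshold c K)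
    {S : List (List ℕ)} (hS : Arranges S K) :
    oddSum (K.map Finset.card) = S.flatten.countP (c < ·) := by
  have h1 : S.map List.length = K.map Finset.card := by
    refine List.ext_getElem (by simpa using hS.length_eq) fun i hi hi' => ?_
    simp only [List.getElem_map]
    simp only [List.length_map] at hi hi'
    rw [← (hS.get hi hi').2, List.toFinset_card_of_nodup (hS.get hi hi').1]
  rw [← h1]
  refine (oddSum_map_length_and S).1 fun i hi x hx => ?_
  have hi' : i < K.length := hS.length_eq ▸ hi
  refine h i hi' x ?_
  rwa [← (hS.get hi hi').2, List.mem_toFinset]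

theorem exists_arranges_self (K : List (Finset ℕ)) : ∃ S, Arranges S K := by
  refine ⟨K.map Finset.toList, ?_⟩
  unfold Arranges
  rw [List.forall₂_map_left_iff]
  exact List.forall₂_same.2 fun B _ => ⟨B.nodup_toList, B.toList_toFinset⟩

theorem Arranges.map_toFinset {S : List (List ℕ)} {K : List (Finset ℕ)} (h : Arranges S K) :
    S.map List.toFinset = K := by
  refine List.ext_getElem (by simpa using h.length_eq) fun i hi hi' => ?_
  simp only [List.length_map] at hi
  rw [List.getElem_map, (h.get hi hi').2]

theorem Arranges.segments_flatten {c : ℕ} {S : List (List ℕ)} {K : List (Finset ℕ)}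
    (h : Arranges S K) (hne : ∀ B ∈ K, B.Nonempty) (hK : IsThreshold c K) :
    segments c S.flatten = S := by
  have hc : ∀ (i : ℕ) (hi : i < S.length), ∀ x ∈ S[i], (c < x ↔ Even i) := by
    intro i hi x hx
    have hi' : i < K.length := h.length_eq ▸ hi
    refine hK i hi' x ?_
    rwa [← (h.get hi hi').2, List.mem_toFinset]
  refine List.splitBy_flatten (h.nil_notMem hne) (fun s hs => ?_) ?_
  · obtain ⟨i, hi, rfl⟩ := List.getElem_of_mem hs
    rw [List.isChain_iff_getElem]
    intro j hj
    rw [decide_eq_true_eq, hc i hi _ (List.getElem_mem _), hc i hi _ (List.getElem_mem _)]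
  · rw [List.isChain_iff_getElem]
    intro i hi
    have hne' : ∀ (j : ℕ) (hj : j < S.length), S[j] ≠ [] := fun j hj he =>
      h.nil_notMem hne (he ▸ List.getElem_mem hj)
    refine ⟨hne' _ _, hne' _ _, ?_⟩
    rw [decide_eq_false_iff_not, hc i (by omega) _ (List.getLast_mem _),
      hc (i + 1) hi _ (List.head_mem _), Nat.even_add_one]
    tauto

theorem arranges_segments {c : ℕ} {π : List ℕ} (hπ : π.Nodup) :
    Arranges (segments c π) ((segments c π).map List.toFinset) := by
  unfold Arranges
  rw [List.forall₂_map_right_iff]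
  refine List.forall₂_same.2 fun s hs => ⟨?_, rfl⟩
  rw [← flatten_segments c π] at hπ
  exact (List.nodup_flatten.1 hπ).1 s hs

/-! ### Products of the `N_α` -/

/-- `P` is the disjoint sum of the ordinal sums of two lists of sets, both of which alternate with
respect to the threshold `c`. -/
structure IsThresholdSum (P : LabeledPoset) (A B : List (Finset ℕ)) (c : ℕ) : Prop where
  nonempty_left : ∀ C ∈ A, C.Nonempty
  nonempty_right : ∀ C ∈ B, C.Nonempty
  threshold_left : IsThreshold c A
  threshold_right : IsThreshold c B
  pairwise_left : A.Pairwise Disjoint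
  pairwise_right : B.Pairwise Disjoint
  disjoint : ∀ x, (∃ C ∈ A, x ∈ C) → ¬ ∃ C ∈ B, x ∈ C
  mem_labels_iff : ∀ x, x ∈ P.labels ↔ (∃ C ∈ A, x ∈ C) ∨ ∃ C ∈ B, x ∈ C
  lt_iff : ∀ x y, P.lt x y ↔ BlockLt A x y ∨ BlockLt B x y

/-- Sets containing elements on the same side of `c` have positions of equal parity, so at least one
set lies between them; the set right after that of `x` is on the other side. -/
theorem IsThreshold.exists_between {c : ℕ} {A : List (Finset ℕ)} (h : IsThreshold c A)
    (hne : ∀ C ∈ A, C.Nonempty) {x y : ℕ} (hxy : BlockLt A x y) (hc : c < x ↔ c < y) :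
    ∃ z, BlockLt A x z ∧ BlockLt A z y ∧ ¬ (c < x ↔ c < z) := by
  obtain ⟨⟨i, hi⟩, ⟨j, hj⟩, hij, hx, hy⟩ := hxy
  have hij' : i < j := hij
  simp only [List.get_eq_getElem] at hx hy
  have h1 := h i hi x hx
  have h2 := h j hj y hy
  obtain ⟨z, hz⟩ := hne _ (List.getElem_mem (show i + 1 < A.length by omega))
  have h3 := h (i + 1) (by omega) z hz
  have hj' : i + 1 ≠ j := by
    rintro rfl
    rw [Nat.even_add_one] at h2
    tauto
  rw [Nat.even_add_one] at h3
  refine ⟨z, ⟨⟨i, hi⟩, ⟨i + 1, by omega⟩, ?_, hx, hz⟩, ⟨⟨i + 1, by omega⟩, ⟨j, hj⟩, ?_, hz, hy⟩,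
    by tauto⟩
  · exact Fin.mk_lt_mk.2 (Nat.lt_succ_self i)
  · exact Fin.mk_lt_mk.2 (by omega)

/-- The first set lies above `c`, so `x` is in a later one and any element of the first set is below
it in the order. -/
theorem IsThreshold.exists_blockLt {c : ℕ} {A : List (Finset ℕ)} (h : IsThreshold c A)
    (hne : ∀ C ∈ A, C.Nonempty) {x : ℕ} (hx : ∃ C ∈ A, x ∈ C) (hc : ¬ c < x) :
    ∃ z, BlockLt A z x := by
  obtain ⟨C, hC, hx⟩ := hx
  obtain ⟨i, hi, rfl⟩ := List.getElem_of_mem hC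
  have h1 := h i hi x hx
  have h0 : i ≠ 0 := by
    rintro rfl
    exact hc (h1.2 Even.zero)
  obtain ⟨z, hz⟩ := hne _ (List.getElem_mem (show 0 < A.length by omega))
  exact ⟨z, ⟨0, by omega⟩, ⟨i, hi⟩, Fin.mk_lt_mk.2 (by omega), hz, hx⟩

namespace IsThresholdSum

variable {P : LabeledPoset} {A B : List (Finset ℕ)} {c : ℕ}

theorem exists_between (h : IsThresholdSum P A B c) {x y : ℕ} (hxy : P.lt x y)
    (hc : c < x ↔ c < y) : ∃ z, P.lt x z ∧ P.lt z y ∧ ¬ (c < x ↔ c < z) := by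
  simp only [h.lt_iff] at hxy ⊢
  rcases hxy with hxy | hxy
  · obtain ⟨z, h1, h2, h3⟩ := h.threshold_left.exists_between h.nonempty_left hxy hc
    exact ⟨z, Or.inl h1, Or.inl h2, h3⟩
  · obtain ⟨z, h1, h2, h3⟩ := h.threshold_right.exists_between h.nonempty_right hxy hc
    exact ⟨z, Or.inr h1, Or.inr h2, h3⟩

theorem exists_lt (h : IsThresholdSum P A B c) {x : ℕ} (hx : x ∈ P.labels) (hc : ¬ c < x) :
    ∃ z, P.lt z x := by
  simp only [h.lt_iff]
  rcases (h.mem_labels_iff x).1 hx with hx | hx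
  · obtain ⟨z, hz⟩ := h.threshold_left.exists_blockLt h.nonempty_left hx hc
    exact ⟨z, Or.inl hz⟩
  · obtain ⟨z, hz⟩ := h.threshold_right.exists_blockLt h.nonempty_right hx hc
    exact ⟨z, Or.inr hz⟩

/-- The first entry of a linear extension is minimal in `P`, and elements not exceeding `c` never
are. -/
theorem lt_head (h : IsThresholdSum P A B c) {π : List ℕ} (hπ : π ∈ P.jordanHolder) :
    ∀ x ∈ π.head?, c < x := by
  obtain ⟨hnd, hlab, hp⟩ := mem_jordanHolder.1 hπ
  intro x hx
  obtain ⟨π, rfl⟩ : ∃ ρ, π = x :: ρ := by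
    cases π with
    | nil => simp at hx
    | cons a ρ =>
      simp only [List.head?_cons, Option.mem_def, Option.some.injEq] at hx
      exact ⟨ρ, by rw [hx]⟩
  by_contra hc
  obtain ⟨z, hz⟩ := h.exists_lt (by rw [← hlab]; simp) hc
  have hzm : z ∈ (P.labels : Set ℕ) := (P.mem_of_lt _ _ hz).1
  rw [← hlab, Finset.mem_coe, List.mem_toFinset, List.mem_cons] at hzm
  rcases hzm with rfl | hzm
  · exact P.irrefl _ hz
  · exact (List.pairwise_cons.1 hp).1 z hzm hz

theorem isThreshold_segments (h : IsThresholdSum P A B c) {π : List ℕ}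
    (hπ : π ∈ P.jordanHolder) : IsThreshold c ((segments c π).map List.toFinset) := by
  intro i hi x hx
  simp only [List.length_map] at hi
  simp only [List.getElem_map, List.mem_toFinset] at hx
  exact lt_iff_even_of_mem_segments (h.lt_head hπ) i hi x hx

theorem not_lt_of_mem_segments (h : IsThresholdSum P A B c) {π : List ℕ}
    (hπ : π ∈ P.jordanHolder) {s : List ℕ} (hs : s ∈ segments c π) {x y : ℕ} (hx : x ∈ s)
    (hy : y ∈ s) : ¬ P.lt x y := by
  intro hxy
  obtain ⟨hnd, hlab, hp⟩ := mem_jordanHolder.1 hπ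
  obtain ⟨z, hxz, hzy, hc⟩ := h.exists_between hxy (lt_iff_lt_of_mem_segments hs hx hy)
  have hz : z ∈ (P.labels : Set ℕ) := (P.mem_of_lt _ _ hxz).2
  rw [← hlab, Finset.mem_coe, List.mem_toFinset, ← flatten_segments c π] at hz
  rw [← flatten_segments c π] at hp
  have hc' : z ∉ s := fun hzs => hc (lt_iff_lt_of_mem_segments hs hx hzs)
  obtain ⟨u, v, huv⟩ := List.append_of_mem hs
  rw [huv, List.flatten_append, List.flatten_cons] at hz hp
  rw [List.pairwise_append, List.pairwise_append] at hp
  simp only [List.mem_append] at hz hp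
  -- An intermediate `z` must occur between `x` and `y`. An earlier segment contradicts `x < z` in
  -- `P`, a later one `z < y`, and the same segment is on the wrong side of `c`.
  rcases hz with hz | hz | hz
  · exact hp.2.2 z hz x (Or.inl hx) hxz
  · exact hc' hz
  · exact hp.2.1.2.2 y hy z hz hzy

theorem nonempty_segments {π : List ℕ} :
    ∀ C ∈ (segments c π).map List.toFinset, C.Nonempty := by
  intro C hC
  obtain ⟨s, hs, rfl⟩ := List.mem_map.1 hC
  rw [List.toFinset_nonempty_iff]
  exact ne_nil_of_mem_segments hs

theorem pairwise_segments {π : List ℕ} (hπ : π.Nodup) :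
    ((segments c π).map List.toFinset).Pairwise Disjoint := by
  rw [← flatten_segments c π, List.nodup_flatten] at hπ
  rw [List.pairwise_map]
  exact hπ.2.imp fun h => List.disjoint_toFinset_iff_disjoint.2 h

/-- The segments of `π` can be permuted internally at will, since each is an antichain of `P`. This
makes the fiber of `K_T` the whole set of linear extensions of an ordinal sum. -/
theorem mem_jordanHolder_and_iff (h : IsThresholdSum P A B c) {π : List ℕ}
    (hπ : π ∈ P.jordanHolder) (ρ : List ℕ) :
    ρ ∈ P.jordanHolder ∧ (segments c ρ).map List.toFinset = (segments c π).map List.toFinset ↔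
      ∃ S, Arranges S ((segments c π).map List.toFinset) ∧ S.flatten = ρ := by
  constructor
  · rintro ⟨hρ, he⟩
    exact ⟨_, he ▸ arranges_segments (mem_jordanHolder.1 hρ).1, flatten_segments c ρ⟩
  · rintro ⟨S, hS, rfl⟩
    obtain ⟨hnd, hlab, hp⟩ := mem_jordanHolder.1 hπ
    have hS₀ : Arranges (segments c π) ((segments c π).map List.toFinset) := arranges_segments hnd
    have hK := pairwise_segments (c := c) hnd
    have hmem : ∀ x, x ∈ S.flatten ↔ x ∈ π := fun x => by
      rw [hS.mem_flatten_iff, ← hS₀.mem_flatten_iff, flatten_segments]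
    refine ⟨mem_jordanHolder.2 ⟨hS.nodup_flatten hK, ?_, ?_⟩, ?_⟩
    · rw [← hlab]
      ext x
      rw [List.mem_toFinset, hmem, List.mem_toFinset]
    · have hp₀ : π.Pairwise fun x y => ¬ BlockLt ((segments c π).map List.toFinset) y x := by
        have := hS₀.pairwise_flatten hK
        rwa [flatten_segments] at this
      refine (hS.pairwise_flatten hK).imp fun {x y} hn hlt => hn ?_
      have hy : ∃ C ∈ (segments c π).map List.toFinset, y ∈ C := by
        rw [← hS₀.mem_flatten_iff, flatten_segments, ← List.mem_toFinset, hlab]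
        exact (P.mem_of_lt _ _ hlt).1
      have hx : ∃ C ∈ (segments c π).map List.toFinset, x ∈ C := by
        rw [← hS₀.mem_flatten_iff, flatten_segments, ← List.mem_toFinset, hlab]
        exact (P.mem_of_lt _ _ hlt).2
      obtain ⟨C, hC, hyC⟩ := hy
      obtain ⟨D, hD, hxD⟩ := hx
      obtain ⟨i, rfl⟩ := List.mem_iff_get.1 hC
      obtain ⟨j, rfl⟩ := List.mem_iff_get.1 hD
      rcases lt_trichotomy i j with hij | rfl | hij
      · exact ⟨i, j, hij, hyC, hxD⟩
      · exfalso
        simp only [List.get_eq_getElem, List.getElem_map, List.mem_toFinset] at hyC hxD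
        exact h.not_lt_of_mem_segments hπ (List.getElem_mem _) hyC hxD hlt
      · exfalso
        -- Here `P` would put `y` before `x` and the segments of `π` would put `x` before `y`,
        -- whereas `π` respects both orders.
        have hxy : BlockLt ((segments c π).map List.toFinset) x y := ⟨j, i, hij, hxD, hyC⟩
        have hxπ : x ∈ π := by
          rw [← List.mem_toFinset, hlab]
          exact (P.mem_of_lt _ _ hlt).2
        have hyπ : y ∈ π := by
          rw [← List.mem_toFinset, hlab]
          exact (P.mem_of_lt _ _ hlt).1
        obtain ⟨a, ha, rfl⟩ := List.getElem_of_mem hxπ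
        obtain ⟨b, hb, rfl⟩ := List.getElem_of_mem hyπ
        rcases lt_trichotomy a b with hab | rfl | hab
        · exact List.pairwise_iff_getElem.1 hp a b ha hb hab hlt
        · exact P.irrefl _ hlt
        · exact List.pairwise_iff_getElem.1 hp₀ b a hb ha hab hxy
    · rw [hS.segments_flatten nonempty_segments (h.isThreshold_segments hπ), hS.map_toFinset]

/-- Group the linear extensions by their induced partition: each group is the Jordan–Hölder set of
an alternating ordinal sum, and so contributes a single `N`. -/
theorem F_eq_sum_N (h : IsThresholdSum P A B c) :
    P.F R = ∑ K ∈ P.jordanHolder.image (fun π => (segments c π).map List.toFinset),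
      N R (toComp (K.map Finset.card)).2 := by
  classical
  unfold LabeledPoset.F
  rw [← Finset.sum_fiberwise_of_maps_to (g := fun π => (segments c π).map List.toFinset)
    fun π hπ => Finset.mem_image_of_mem (fun π => (segments c π).map List.toFinset) hπ]
  refine Finset.sum_congr rfl fun K hK => ?_
  obtain ⟨π, hπ, rfl⟩ := Finset.mem_image.1 hK
  have hnd := (mem_jordanHolder.1 hπ).1
  have hpos : ∀ C ∈ (segments c π).map List.toFinset, ∀ x ∈ C, 0 < x := by
    intro C hC x hx
    have : ∃ C ∈ (segments c π).map List.toFinset, x ∈ C := ⟨C, hC, hx⟩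
    rw [← (arranges_segments hnd).mem_flatten_iff, flatten_segments, ← List.mem_toFinset,
      (mem_jordanHolder.1 hπ).2.1] at this
    exact P.label_pos x this
  rw [← F_ordinalSum_eq_N (pairwise_segments hnd) hpos nonempty_segments
    (h.isThreshold_segments hπ).isAlternating]
  · unfold LabeledPoset.F
    refine Finset.sum_congr ?_ fun _ _ => rfl
    ext ρ
    rw [Finset.mem_filter, h.mem_jordanHolder_and_iff hπ, mem_jordanHolder_ordinalSum]
  · refine (toComp_blocks fun a ha => ?_).symm
    obtain ⟨C, hC, rfl⟩ := List.mem_map.1 ha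
    exact Finset.card_pos.2 (nonempty_segments C hC)

theorem oddSum_segments (h : IsThresholdSum P A B c) {π : List ℕ} (hπ : π ∈ P.jordanHolder) :
    oddSum (((segments c π).map List.toFinset).map Finset.card) =
      oddSum (A.map Finset.card) + oddSum (B.map Finset.card) := by
  obtain ⟨hnd, hlab, hp⟩ := mem_jordanHolder.1 hπ
  obtain ⟨S, hS⟩ := exists_arranges_self A
  obtain ⟨T, hT⟩ := exists_arranges_self B
  rw [(h.isThreshold_segments hπ).oddSum_map_card (arranges_segments hnd), flatten_segments,
    h.threshold_left.oddSum_map_card hS, h.threshold_right.oddSum_map_card hT,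
    ← List.countP_append]
  refine List.Perm.countP_eq _ ((List.perm_ext_iff_of_nodup hnd ?_).2 fun x => ?_)
  · refine List.nodup_append'.2 ⟨hS.nodup_flatten h.pairwise_left,
      hT.nodup_flatten h.pairwise_right, fun x hx hx' => ?_⟩
    exact h.disjoint x ((hS.mem_flatten_iff x).1 hx) ((hT.mem_flatten_iff x).1 hx')
  · rw [List.mem_append, hS.mem_flatten_iff, hT.mem_flatten_iff, ← h.mem_labels_iff, ← hlab,
      List.mem_toFinset]

end IsThresholdSum

/-- The two unions exchange roles on passing to the tail, hence the joint induction. -/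
theorem mem_oddUnion_and : ∀ (K : List (Finset ℕ)) (x : ℕ),
    (x ∈ oddUnion K ↔ ∃ (i : ℕ) (hi : i < K.length), Even i ∧ x ∈ K[i]) ∧
    (x ∈ evenUnion K ↔ ∃ (i : ℕ) (hi : i < K.length), ¬ Even i ∧ x ∈ K[i])
  | [], x => by simp [evenUnion, oddUnion]
  | A :: K, x => by
    have h1 : oddUnion (A :: K) = A ∪ evenUnion K := by
      cases K <;> simp [evenUnion, oddUnion]
    have h2 : evenUnion (A :: K) = oddUnion K := rfl
    rw [h1, h2, Finset.mem_union, (mem_oddUnion_and K x).1, (mem_oddUnion_and K x).2]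
    constructor
    · constructor
      · rintro (h | ⟨i, hi, he, h⟩)
        · exact ⟨0, Nat.succ_pos _, Even.zero, h⟩
        · exact ⟨i + 1, Nat.succ_lt_succ hi, Nat.even_add_one.2 he, h⟩
      · rintro ⟨i, hi, he, h⟩
        rcases i with _ | i
        · exact Or.inl h
        · exact Or.inr ⟨i, Nat.lt_of_succ_lt_succ hi, Nat.even_add_one.1 he, h⟩
    · constructor
      · rintro ⟨i, hi, he, h⟩
        exact ⟨i + 1, Nat.succ_lt_succ hi, by rw [Nat.even_add_one]; exact not_not.2 he, h⟩
      · rintro ⟨i, hi, he, h⟩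
        rcases i with _ | i
        · exact absurd Even.zero he
        · rw [Nat.even_add_one, not_not] at he
          exact ⟨i, Nat.lt_of_succ_lt_succ hi, he, h⟩

theorem IsThreshold.mem_oddUnion_iff {c : ℕ} {K : List (Finset ℕ)} (h : IsThreshold c K) (x : ℕ) :
    x ∈ oddUnion K ↔ (∃ C ∈ K, x ∈ C) ∧ c < x := by
  rw [(mem_oddUnion_and K x).1]
  constructor
  · rintro ⟨i, hi, he, hx⟩
    exact ⟨⟨_, List.getElem_mem hi, hx⟩, (h i hi x hx).2 he⟩
  · rintro ⟨⟨C, hC, hx⟩, hc⟩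
    obtain ⟨i, hi, rfl⟩ := List.getElem_of_mem hC
    exact ⟨i, hi, (h i hi x hx).1 hc, hx⟩

theorem IsThreshold.mem_evenUnion_iff {c : ℕ} {K : List (Finset ℕ)} (h : IsThreshold c K) (x : ℕ) :
    x ∈ evenUnion K ↔ (∃ C ∈ K, x ∈ C) ∧ ¬ c < x := by
  rw [(mem_oddUnion_and K x).2]
  constructor
  · rintro ⟨i, hi, he, hx⟩
    exact ⟨⟨_, List.getElem_mem hi, hx⟩, fun hc => he ((h i hi x hx).1 hc)⟩
  · rintro ⟨⟨C, hC, hx⟩, hc⟩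
    obtain ⟨i, hi, rfl⟩ := List.getElem_of_mem hC
    exact ⟨i, hi, fun he => hc ((h i hi x hx).2 he), hx⟩

section PosetQ

variable {m n : ℕ} (α : Composition m) (β : Composition n)

theorem isThresholdSum_posetQ :
    IsThresholdSum (posetQ α β) (blocksA α β) (blocksB α β) (corank α + corank β) where
  nonempty_left := nonempty_of_mem_altBlocks fun _ => α.blocks_pos
  nonempty_right := nonempty_of_mem_altBlocks fun _ => β.blocks_pos
  threshold_left := isThreshold_altBlocks le_rfl (by change 0 + corank α ≤ _; omega)
  threshold_right := isThreshold_altBlocks (by omega) (by change corank α + corank β ≤ _; omega)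
  pairwise_left := pairwise_altBlocks _ _ _ (Or.inl (by change 0 + corank α ≤ _; omega))
  pairwise_right := pairwise_altBlocks _ _ _
    (Or.inl (by change corank α + corank β ≤ _; omega))
  disjoint := by
    rintro x ⟨C, hC, hx⟩ ⟨D, hD, hx'⟩
    have h1 := mem_altBlocks _ _ _ C hC x hx
    have h2 := mem_altBlocks _ _ _ D hD x hx'
    change (_ ∧ _ ≤ _ + rank α) ∨ (_ ∧ _ ≤ _ + corank α) at h1
    change (_ ∧ _ ≤ _ + rank β) ∨ (_ ∧ _ ≤ _ + corank β) at h2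
    omega
  mem_labels_iff x := by
    simp only [posetQ, disjointSum, Finset.mem_union, altPoset, mem_labels_ordinalSum]
    rfl
  lt_iff _ _ := Iff.rfl

/-- Two labels of `Q` share a member of `{T₁, T₂}` exactly when they are on the same side of the
threshold. -/
theorem inducedPartition_partitionT {π : List ℕ} (hπ : π ∈ (posetQ α β).jordanHolder) :
    inducedPartition (partitionT α β) π =
      (segments (corank α + corank β) π).map List.toFinset := by
  have h := isThresholdSum_posetQ α β
  unfold inducedPartition segments
  congr 1
  refine splitBy_congr fun x hx y hy => ?_
  have hlab : ∀ x ∈ π, x ∈ (posetQ α β).labels := fun x hx => by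
    rwa [← (mem_jordanHolder.1 hπ).2.1, List.mem_toFinset]
  have hx' := (h.mem_labels_iff x).1 (hlab x hx)
  have hy' := (h.mem_labels_iff y).1 (hlab y hy)
  rw [decide_eq_decide]
  simp only [partitionT, Finset.mem_insert, Finset.mem_singleton, exists_eq_or_imp,
    exists_eq_left, Finset.mem_union, h.threshold_left.mem_oddUnion_iff,
    h.threshold_right.mem_oddUnion_iff, h.threshold_left.mem_evenUnion_iff,
    h.threshold_right.mem_evenUnion_iff, ← or_and_right, hx', hy', true_and]
  by_cases h1 : corank α + corank β < x <;> by_cases h2 : corank α + corank β < y <;>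
    simp [h1, h2]

theorem inducedPartitions_partitionT :
    inducedPartitions (posetQ α β) (partitionT α β) = (posetQ α β).jordanHolder.image
      (fun π => (segments (corank α + corank β) π).map List.toFinset) :=
  Finset.image_congr fun _ hπ => inducedPartition_partitionT α β hπ

variable (R) in
theorem N_mul_N : N R α * N R β =
    ∑ K ∈ inducedPartitions (posetQ α β) (partitionT α β), N R (toComp (K.map Finset.card)).2 := by
  rw [inducedPartitions_partitionT, ← (isThresholdSum_posetQ α β).F_eq_sum_N, posetQ, ← F_mul_F,
    F_altPoset, F_altPoset]

variable {α β}

theorem isAlternating_of_mem_inducedPartitions {K : List (Finset ℕ)}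
    (hK : K ∈ inducedPartitions (posetQ α β) (partitionT α β)) : IsAlternating K := by
  rw [inducedPartitions_partitionT] at hK
  obtain ⟨π, hπ, rfl⟩ := Finset.mem_image.1 hK
  exact ((isThresholdSum_posetQ α β).isThreshold_segments hπ).isAlternating

theorem oddSum_of_mem_inducedPartitions {K : List (Finset ℕ)}
    (hK : K ∈ inducedPartitions (posetQ α β) (partitionT α β)) :
    oddSum (K.map Finset.card) = rank α + rank β := by
  rw [inducedPartitions_partitionT] at hK
  obtain ⟨π, hπ, rfl⟩ := Finset.mem_image.1 hK
  rw [(isThresholdSum_posetQ α β).oddSum_segments hπ, blocksA, blocksB, map_card_altBlocks,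
    map_card_altBlocks]
  rfl

theorem toComp_blocks_of_mem_inducedPartitions {K : List (Finset ℕ)}
    (hK : K ∈ inducedPartitions (posetQ α β) (partitionT α β)) :
    (toComp (K.map Finset.card)).2.blocks = K.map Finset.card := by
  rw [inducedPartitions_partitionT] at hK
  obtain ⟨π, hπ, rfl⟩ := Finset.mem_image.1 hK
  refine toComp_blocks fun a ha => ?_
  obtain ⟨C, hC, rfl⟩ := List.mem_map.1 ha
  exact Finset.card_pos.2 (IsThresholdSum.nonempty_segments C hC)

end PosetQ

/-! ### The fundamental basis -/

theorem eq_of_boundaries_eq {n : ℕ} {α β : Composition n} (h : α.boundaries = β.boundaries) :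
    α = β :=
  (compositionEquiv n).injective (CompositionAsSet.ext h)

theorem monomialBasis_repr_fundamentalQ (α β : Comp) :
    (monomialBasis R).repr (fundamentalQ R α.2) β =
      if h : β.1 = α.1 then if α.2.boundaries ⊆ (β.2.cast h).boundaries then 1 else 0 else 0 := by
  classical
  obtain ⟨n, α⟩ := α
  obtain ⟨k, β⟩ := β
  have h1 : fundamentalQ R α = ∑ γ : Composition n with α.boundaries ⊆ γ.boundaries,
      monomialBasis R ⟨n, γ⟩ :=
    Finset.sum_congr rfl fun γ _ => (monomialBasis_apply ⟨n, γ⟩).symm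
  simp only [h1, map_sum, Module.Basis.repr_self, Finsupp.finsetSum_apply, Finsupp.single_apply]
  split_ifs with hk hs
  · subst hk
    rw [Composition.cast_rfl] at hs
    rw [Finset.sum_eq_single β]
    · simp
    · intro γ _ hne
      rw [if_neg]
      simpa using hne
    · intro hn
      exact absurd (Finset.mem_filter.2 ⟨Finset.mem_univ β, hs⟩) hn
  · subst hk
    refine Finset.sum_eq_zero fun γ hγ => if_neg fun he => hs ?_
    simp only [Sigma.mk.injEq, heq_eq_eq, true_and] at he
    subst he
    exact (Finset.mem_filter.1 hγ).2
  · refine Finset.sum_eq_zero fun γ _ => if_neg fun he => hk ?_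
    exact (congrArg Sigma.fst he).symm

variable (R) in
-- A strict refinement has more parts, and the number of parts is bounded by the weight, so
-- refinement is a well-founded triangular order.
theorem exists_fundamentalBasis :
    ∃ b : Module.Basis Comp R (QSym R), ⇑b = fun α : Comp => fundamentalQ R α.2 := by
  classical
  refine exists_basis_of_triangular (monomialBasis R) _
    (fun β α => β.1 = α.1 ∧ α.2.length < β.2.length) ?_ ?_ ?_ ?_
  · refine Subrelation.wf ?_ (measure fun c : Comp => c.1 - c.2.length).wf
    intro β α ⟨h1, h2⟩
    change β.1 - β.2.length < α.1 - α.2.length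
    have := β.2.length_le
    omega
  · exact fun i j k h1 h2 => ⟨h1.1.trans h2.1, h2.2.trans h1.2⟩
  · intro α
    rw [monomialBasis_repr_fundamentalQ]
    simp
  · intro α β h
    rw [monomialBasis_repr_fundamentalQ] at h
    obtain ⟨n, α⟩ := α
    obtain ⟨k, β⟩ := β
    dsimp only at h
    split_ifs at h with hk hs
    · subst hk
      rw [Composition.cast_rfl] at hs
      rcases eq_or_ne α.boundaries β.boundaries with he | hne
      · exact Or.inl (by rw [eq_of_boundaries_eq he])
      · refine Or.inr ⟨rfl, ?_⟩
        have := Finset.card_lt_card (lt_of_le_of_ne hs hne)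
        rw [α.card_boundaries_eq_succ_length, β.card_boundaries_eq_succ_length] at this
        exact Nat.lt_of_succ_lt_succ this
    · exact absurd rfl h
    · exact absurd rfl h

/-! ### Ascent words -/

/-- The word that records for all consecutive entries whether they form an ascent. -/
def ascentWord : List ℕ → List Bool
  | [] => []
  | [_] => []
  | x :: y :: l => decide (x < y) :: ascentWord (y :: l)

theorem length_ascentWord : ∀ l : List ℕ, (ascentWord l).length = l.length - 1
  | [] => rfl
  | [_] => rfl
  | _ :: y :: l => by simp [ascentWord, length_ascentWord (y :: l)]

theorem getElem_ascentWord : ∀ (l : List ℕ) (j : ℕ) (hj : j + 1 < l.length),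
    (ascentWord l)[j]'(by rw [length_ascentWord]; omega) = decide (l[j] < l[j + 1])
  | [], j, hj => by simp at hj
  | [_], j, hj => by simp at hj
  | x :: y :: l, 0, hj => rfl
  | x :: y :: l, j + 1, hj => getElem_ascentWord (y :: l) j (by simpa using hj)

theorem ascentWord_append : ∀ {σ τ : List ℕ} (hσ : σ ≠ []) (hτ : τ ≠ []),
    ascentWord (σ ++ τ) = ascentWord σ ++ decide (σ.getLast hσ < τ.head hτ) :: ascentWord τ
  | [], _, h, _ => absurd rfl h
  | [x], [], _, h => absurd rfl h
  | [x], y :: τ, _, _ => rfl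
  | x :: y :: σ, τ, _, hτ => by
    have := ascentWord_append (σ := y :: σ) (by simp) hτ
    simp only [List.cons_append, ascentWord] at this ⊢
    rw [this]
    simp

theorem ascentWord_eq_of_runComposition_eq {π ρ : List ℕ}
    (h : (⟨_, runComposition π⟩ : Comp) = ⟨_, runComposition ρ⟩) :
    ascentWord π = ascentWord ρ := by
  have hlen : π.length = ρ.length := congrArg Sigma.fst h
  have hps : ∀ j, IsPartialSum (runComposition π) j ↔ IsPartialSum (runComposition ρ) j := by
    intro j
    have := congrArg (fun c : Comp => IsPartialSum c.2 j) h
    exact iff_of_eq this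
  refine List.ext_getElem (by rw [length_ascentWord, length_ascentWord, hlen]) fun j h1 h2 => ?_
  rw [length_ascentWord] at h1 h2
  rw [getElem_ascentWord π j (by omega), getElem_ascentWord ρ j (by omega), decide_eq_decide]
  exact not_iff_not.1 ((isPartialSum_runComposition π (by omega)).symm.trans
    ((hps (j + 1)).trans (isPartialSum_runComposition ρ (by omega))))

/-- The ascent word `b ⋯ b b' ⋯ b' b ⋯ b ⋯`, with `b'` the negation of `b`, whose constant segments
have the lengths in `l`, except that the first is shorter by one. -/
def zigzagWord : Bool → List ℕ → List Bool
  | _, [] => []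
  | b, [a] => List.replicate (a - 1) b
  | b, a :: a' :: l => List.replicate (a - 1) b ++ (!b) :: zigzagWord (!b) (a' :: l)

/-- `w` is an ascent word of a concatenation of sequences with the lengths in `l`, where the
comparisons at the joints alternate between the negation of `b` and `b`. -/
def FitsWord : Bool → List ℕ → List Bool → Prop
  | _, [], w => w = []
  | _, [a], w => w.length = a - 1
  | b, a :: a' :: l, w => ∃ u w', u.length = a - 1 ∧ w = u ++ (!b) :: w' ∧ FitsWord (!b) (a' :: l) w'

/-- The first `!b` of the zigzag word of `l'` that ends its initial run marks the first joint of
`l'`, while `l` demands a `!b` at its own first joint. So the first part of `l'` cannot exceed that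
of `l`; if they agree, compare the tails. -/
theorem le_of_fitsWord_zigzagWord : ∀ {b : Bool} {l l' : List ℕ}, (∀ a ∈ l, 0 < a) →
    (∀ a ∈ l', 0 < a) → l.sum = l'.sum → FitsWord b l (zigzagWord b l') → l' ≤ l
  | _, [], [], _, _, _, _ => le_rfl
  | _, [], a' :: l', _, hl', hs, _ => by
    have := hl' a' (by simp)
    simp at hs
    omega
  | _, a :: l, [], hl, _, hs, _ => by
    have := hl a (by simp)
    simp at hs
    omega
  | _, [a], [a'], _, _, hs, _ => by
    simp only [List.sum_cons, List.sum_nil, add_zero] at hs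
    rw [hs]
  | _, [a], a' :: c' :: l', _, hl', hs, _ => by
    have := hl' c' (by simp)
    simp only [List.sum_cons, List.sum_nil, add_zero] at hs
    exact (List.cons_lt_cons_iff.2 (Or.inl (by omega))).le
  | b, a :: c :: l, [a'], hl, _, hs, ⟨u, w', _, hw, _⟩ => by
    have : (!b) ∈ List.replicate (a' - 1) b := by
      change (!b) ∈ zigzagWord b [a']
      rw [hw]
      simp
    simp at this
  | b, a :: c :: l, a' :: c' :: l', hl, hl', hs, ⟨u, w', hu, hw, hf⟩ => by
    have ha := hl a (by simp)
    have ha' := hl' a' (by simp)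
    rcases lt_trichotomy a' a with h | rfl | h
    · exact (List.cons_lt_cons_iff.2 (Or.inl h)).le
    · simp only [zigzagWord] at hw
      obtain ⟨-, h2⟩ := List.append_inj hw (by simp [hu])
      rw [← (List.cons.inj h2).2] at hf
      have := le_of_fitsWord_zigzagWord (fun x hx => hl x (List.mem_cons_of_mem _ hx))
        (fun x hx => hl' x (List.mem_cons_of_mem _ hx)) (by simpa using hs) hf
      exact List.cons_le_cons a' this
    -- If `a < a'`, position `a - 1` still lies in the initial run of `b`, but the first joint of
    -- `l` requires `!b` there.
    · exfalso
      simp only [zigzagWord] at hw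
      have h1 := congrArg (fun v : List Bool => v[a - 1]?) hw
      rw [List.getElem?_append_left (by simp; omega), List.getElem?_append_right (by omega), hu,
        List.getElem?_replicate_of_lt (by omega)] at h1
      simp at h1

/-- Consecutive sets of `K` are comparable, alternately in the two possible ways; `b` tells whether
the first set is above the second. -/
def AlternatesFrom (b : Bool) (K : List (Finset ℕ)) : Prop :=
  ∀ (i : ℕ) (hi : i + 1 < K.length), ∀ x ∈ K[i], ∀ y ∈ K[i + 1],
    if (Even i ↔ b = true) then y < x else x < y

theorem AlternatesFrom.tail {b : Bool} {A : Finset ℕ} {K : List (Finset ℕ)}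
    (h : AlternatesFrom b (A :: K)) : AlternatesFrom (!b) K := by
  intro i hi x hx y hy
  have := h (i + 1) (Nat.succ_lt_succ hi) x hx y hy
  simp only [Nat.even_add_one] at this
  cases b <;> simpa using this

theorem IsAlternating.alternatesFrom {K : List (Finset ℕ)} (h : IsAlternating K) :
    AlternatesFrom true K := by
  intro i hi x hx y hy
  simpa using h i hi x hx y hy

/-- The comparison at a joint does not depend on the arrangements, because all of one block lies
above all of the next, or below it. -/
theorem ascentWord_flatten_cons {b : Bool} {A A' : Finset ℕ} {K : List (Finset ℕ)}
    {σ : List ℕ} {S : List (List ℕ)} (hK : AlternatesFrom b (A :: A' :: K)) (hA : A.Nonempty)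
    (hA' : A'.Nonempty) (hσ : σ.toFinset = A) (hS : Arranges S (A' :: K)) :
    ascentWord (σ :: S).flatten = ascentWord σ ++ (!b) :: ascentWord S.flatten := by
  obtain ⟨τ, S, rfl⟩ : ∃ τ S', S = τ :: S' := by
    cases hS with
    | cons h h' => exact ⟨_, _, rfl⟩
  have hτ : τ.toFinset = A' := by
    cases hS with
    | cons h h' => exact h.2
  have hσ0 : σ ≠ [] := by rwa [← List.toFinset_nonempty_iff, hσ]
  have hτ0 : τ ≠ [] := by rwa [← List.toFinset_nonempty_iff, hτ]
  have hτS : (τ :: S).flatten ≠ [] := by simp [hτ0]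
  rw [List.flatten_cons, ascentWord_append hσ0 hτS]
  congr 2
  have h1 : (τ :: S).flatten.head hτS ∈ A' := by
    have : (τ :: S).flatten.head hτS = τ.head hτ0 := by
      simp only [List.flatten_cons]
      exact List.head_append_of_ne_nil hτ0
    rw [this, ← hτ, List.mem_toFinset]
    exact List.head_mem _
  have h2 : σ.getLast hσ0 ∈ A := by
    rw [← hσ, List.mem_toFinset]
    exact List.getLast_mem _
  have h3 := hK 0 (by simp) _ h2 _ h1
  cases b
  · simpa using h3
  · simpa using (show _ from h3 : _ < _).le

theorem fitsWord_ascentWord : ∀ {b : Bool} {K : List (Finset ℕ)} {S : List (List ℕ)},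
    AlternatesFrom b K → (∀ B ∈ K, B.Nonempty) → Arranges S K →
    FitsWord b (K.map Finset.card) (ascentWord S.flatten)
  | _, [], _, _, _, List.Forall₂.nil => rfl
  | _, [A], _, _, _, List.Forall₂.cons hσ List.Forall₂.nil => by
    simp only [List.flatten_cons, List.flatten_nil, List.append_nil, List.map_cons, List.map_nil,
      FitsWord]
    rw [length_ascentWord, ← hσ.2, List.toFinset_card_of_nodup hσ.1]
  | b, A :: A' :: K, σ :: S, hK, hne, List.Forall₂.cons hσ hS => by
    refine ⟨ascentWord σ, ascentWord S.flatten, ?_,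
      ascentWord_flatten_cons hK (hne A (by simp)) (hne A' (by simp)) hσ.2 hS,
      fitsWord_ascentWord hK.tail (fun B hB => hne B (List.mem_cons_of_mem _ hB)) hS⟩
    rw [length_ascentWord, ← hσ.2, List.toFinset_card_of_nodup hσ.1]

theorem ascentWord_eq_replicate_iff {b : Bool} : ∀ {σ : List ℕ}, σ.Nodup →
    (ascentWord σ = List.replicate (σ.length - 1) b ↔
      σ.IsChain fun x y => if b then x < y else y < x)
  | [], _ => by simp [ascentWord]
  | [x], _ => by simp [ascentWord]
  | x :: y :: σ, h => by
    have h1 := ascentWord_eq_replicate_iff (b := b) h.of_cons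
    have hxy : x ≠ y := fun he => by simp [he] at h
    simp only [ascentWord, List.length_cons, Nat.add_sub_cancel, List.isChain_cons_cons] at h1 ⊢
    rw [List.replicate_succ, List.cons.injEq, h1]
    refine and_congr_left fun _ => ?_
    cases b
    · simp
      omega
    · simp

/-- A constant ascent word forces the increasing or the decreasing order of the set. -/
theorem existsUnique_ascentWord_eq_replicate (b : Bool) (A : Finset ℕ) :
    ∃! σ : List ℕ, (σ.Nodup ∧ σ.toFinset = A) ∧
      ascentWord σ = List.replicate (A.card - 1) b := by
  have htr : Trans (fun x y : ℕ => if b = true then x < y else y < x)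
      (fun x y : ℕ => if b = true then x < y else y < x)
      (fun x y : ℕ => if b = true then x < y else y < x) := by
    refine ⟨fun {x y z} h1 h2 => ?_⟩
    split_ifs at *
    exacts [h1.trans h2, h2.trans h1]
  have hcard : ∀ σ : List ℕ, σ.Nodup → σ.toFinset = A → A.card = σ.length := fun σ h1 h2 => by
    rw [← h2, List.toFinset_card_of_nodup h1]
  refine existsUnique_of_exists_of_unique ?_ ?_
  · obtain ⟨σ, h1, h2, h3⟩ : ∃ σ : List ℕ, σ.Nodup ∧ σ.toFinset = A ∧
        σ.IsChain fun x y => if b = true then x < y else y < x := by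
      cases b
      · refine ⟨A.sort (· ≥ ·), A.sort_nodup _, A.sort_toFinset _, ?_⟩
        simpa using A.sortedGT_sort.isChain
      · refine ⟨A.sort (· ≤ ·), A.sort_nodup _, A.sort_toFinset _, ?_⟩
        simpa using A.sortedLT_sort.isChain
    refine ⟨σ, ⟨h1, h2⟩, ?_⟩
    rw [hcard σ h1 h2]
    exact (ascentWord_eq_replicate_iff h1).2 h3
  · rintro σ τ ⟨⟨h1, h2⟩, h3⟩ ⟨⟨h1', h2'⟩, h3'⟩
    rw [hcard σ h1 h2, ascentWord_eq_replicate_iff h1, List.isChain_iff_pairwise] at h3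
    rw [hcard τ h1' h2', ascentWord_eq_replicate_iff h1', List.isChain_iff_pairwise] at h3'
    have hperm : σ.Perm τ := (List.perm_ext_iff_of_nodup h1 h1').2 fun x => by
      rw [← List.mem_toFinset, h2, ← h2', List.mem_toFinset]
    refine hperm.eq_of_pairwise (fun x y _ _ hxy hyx => ?_) h3 h3'
    split_ifs at hxy hyx <;> omega

theorem existsUnique_arranges_zigzagWord : ∀ {b : Bool} {K : List (Finset ℕ)},
    AlternatesFrom b K → (∀ B ∈ K, B.Nonempty) →
    ∃! S, Arranges S K ∧ ascentWord S.flatten = zigzagWord b (K.map Finset.card)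
  | _, [], _, _ => ⟨[], ⟨List.Forall₂.nil, rfl⟩, fun _ h => by cases h.1; rfl⟩
  | b, [A], _, _ => by
    obtain ⟨σ, ⟨h1, h2⟩, h3⟩ := existsUnique_ascentWord_eq_replicate b A
    refine ⟨[σ], ⟨List.Forall₂.cons h1 List.Forall₂.nil, by simpa [zigzagWord] using h2⟩, ?_⟩
    rintro _ ⟨h, h2'⟩
    obtain _ | ⟨h1', h4'⟩ := h
    obtain _ | _ := h4'
    rw [h3 _ ⟨h1', by simpa [zigzagWord] using h2'⟩]
  | b, A :: A' :: K, hK, hne => by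
    obtain ⟨σ, ⟨h1, h2⟩, h3⟩ := existsUnique_ascentWord_eq_replicate b A
    obtain ⟨S, ⟨h4, h5⟩, h6⟩ := existsUnique_arranges_zigzagWord hK.tail
      fun B hB => hne B (List.mem_cons_of_mem _ hB)
    have hA := hne A (by simp)
    have hA' := hne A' (by simp)
    refine ⟨σ :: S, ⟨List.Forall₂.cons h1 h4, ?_⟩, ?_⟩
    · rw [ascentWord_flatten_cons hK hA hA' h1.2 h4, h2, h5]
      rfl
    · rintro _ ⟨h, h2'⟩
      obtain _ | @⟨σ', _, S', _, h1', h4'⟩ := h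
      rw [ascentWord_flatten_cons hK hA hA' h1'.2 h4'] at h2'
      obtain ⟨h7, h8⟩ := List.append_inj h2' (by
        rw [length_ascentWord, ← List.toFinset_card_of_nodup h1'.1, h1'.2, List.length_replicate])
      rw [h3 σ' ⟨h1', h7⟩, h6 S' ⟨h4', (List.cons.inj h8).2⟩]

/-! ### The basis `N_α` -/

theorem mem_jordanHolder_posetP {n : ℕ} {α : Composition n} {π : List ℕ} :
    π ∈ (posetP α).jordanHolder ↔
      ∃ S, Arranges S (altBlocks (corank α) 0 α.blocks) ∧ S.flatten = π := by
  unfold posetP altPoset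
  exact mem_jordanHolder_ordinalSum

theorem fitsWord_of_mem_jordanHolder {n : ℕ} {α : Composition n} {π : List ℕ}
    (hπ : π ∈ (posetP α).jordanHolder) : FitsWord true α.blocks (ascentWord π) := by
  obtain ⟨S, hS, rfl⟩ := mem_jordanHolder_posetP.1 hπ
  have h := fitsWord_ascentWord
    (isThreshold_altBlocks le_rfl (Nat.zero_add _).le).isAlternating.alternatesFrom
    (nonempty_of_mem_altBlocks fun _ => α.blocks_pos) hS
  rwa [map_card_altBlocks] at h

theorem existsUnique_zigzag {n : ℕ} (α : Composition n) :
    ∃! π, π ∈ (posetP α).jordanHolder ∧ ascentWord π = zigzagWord true α.blocks := by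
  obtain ⟨S, ⟨h1, h2⟩, h3⟩ := existsUnique_arranges_zigzagWord
    (isThreshold_altBlocks (l := α.blocks) (o := corank α) (e := 0) le_rfl
      (Nat.zero_add _).le).isAlternating.alternatesFrom
    (nonempty_of_mem_altBlocks fun _ => α.blocks_pos)
  rw [map_card_altBlocks] at h2 h3
  refine ⟨S.flatten, ⟨mem_jordanHolder_posetP.2 ⟨S, h1, rfl⟩, h2⟩, ?_⟩
  rintro _ ⟨hπ, hw⟩
  obtain ⟨T, hT, rfl⟩ := mem_jordanHolder_posetP.1 hπ
  rw [h3 T ⟨hT, hw⟩]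

/-- The linear extension of `P_α` that lists `A₁, A₃, …` in increasing and `A₂, A₄, …` in decreasing
order. -/
noncomputable def zigzag (α : Comp) : List ℕ := (existsUnique_zigzag α.2).choose

theorem zigzag_mem (α : Comp) : zigzag α ∈ (posetP α.2).jordanHolder :=
  (existsUnique_zigzag α.2).choose_spec.1.1

theorem ascentWord_zigzag (α : Comp) : ascentWord (zigzag α) = zigzagWord true α.2.blocks :=
  (existsUnique_zigzag α.2).choose_spec.1.2

theorem eq_zigzag {α : Comp} {π : List ℕ} (hπ : π ∈ (posetP α.2).jordanHolder)
    (h : ascentWord π = zigzagWord true α.2.blocks) : π = zigzag α :=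
  (existsUnique_zigzag α.2).choose_spec.2 π ⟨hπ, h⟩

theorem length_of_mem_jordanHolder_posetP {n : ℕ} {α : Composition n} {π : List ℕ}
    (hπ : π ∈ (posetP α).jordanHolder) : π.length = n := by
  obtain ⟨S, hS, rfl⟩ := mem_jordanHolder_posetP.1 hπ
  have h1 : S.map List.length = α.blocks := by
    rw [← map_card_altBlocks α.blocks (corank α) 0, ← hS.map_toFinset, List.map_map]
    refine List.map_congr_left fun σ hσ => ?_
    obtain ⟨i, hi, rfl⟩ := List.getElem_of_mem hσ
    exact (List.toFinset_card_of_nodup (hS.get hi (hS.length_eq ▸ hi)).1).symm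
  rw [List.length_flatten, h1, α.blocks_sum]

/-- The run composition of `zigzag α`. -/
noncomputable def zigzagComp (α : Comp) : Comp := ⟨_, runComposition (zigzag α)⟩

theorem zigzagComp_fst (α : Comp) : (zigzagComp α).1 = α.1 :=
  length_of_mem_jordanHolder_posetP (zigzag_mem α)

theorem blocks_le_of_runComposition_eq {α β : Comp} {π : List ℕ}
    (hπ : π ∈ (posetP α.2).jordanHolder) (h : ⟨_, runComposition π⟩ = zigzagComp β) :
    β.1 = α.1 ∧ β.2.blocks ≤ α.2.blocks := by
  have hw := (ascentWord_eq_of_runComposition_eq h).trans (ascentWord_zigzag β)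
  have h1 : β.1 = α.1 := by
    rw [← length_of_mem_jordanHolder_posetP hπ, ← zigzagComp_fst, ← h]
  refine ⟨h1, le_of_fitsWord_zigzagWord (fun _ => α.2.blocks_pos) (fun _ => β.2.blocks_pos)
    (by rw [α.2.blocks_sum, β.2.blocks_sum, h1]) (hw ▸ fitsWord_of_mem_jordanHolder hπ)⟩

/-- Equal images give lexicographic inequalities in both directions, hence injectivity; weights are
preserved and each weight has finitely many compositions, so surjectivity follows. -/
theorem zigzagComp_bijective : Function.Bijective zigzagComp := by
  classical
  have hinj : Function.Injective zigzagComp := by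
    intro α β h
    rw [Composition.sigma_eq_iff_blocks_eq]
    exact le_antisymm (blocks_le_of_runComposition_eq (zigzag_mem β) h.symm).2
      (blocks_le_of_runComposition_eq (zigzag_mem α) h).2
  refine ⟨hinj, fun γ => ?_⟩
  let s : Finset Comp := Finset.univ.map (Function.Embedding.sigmaMk (β := Composition) γ.1)
  have hs : ∀ α : Comp, α ∈ s ↔ α.1 = γ.1 := by
    rintro ⟨n, α⟩
    simp only [s, Finset.mem_map, Finset.mem_univ, true_and, Function.Embedding.sigmaMk_apply]
    constructor
    · rintro ⟨δ, h⟩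
      exact (congrArg Sigma.fst h).symm
    · rintro rfl
      exact ⟨α, rfl⟩
  obtain ⟨α, -, h⟩ := Finset.surjOn_of_injOn_of_card_le zigzagComp
    (fun α hα => (hs _).2 ((zigzagComp_fst α).trans ((hs α).1 hα))) hinj.injOn le_rfl
    (show γ ∈ (s : Set Comp) from (hs γ).2 rfl)
  exact ⟨α, h⟩

variable (R) in
-- The coefficient of `N_α` at the fundamental function indexed by `zigzagComp β` counts linear
-- extensions of `P_α` with the runs of `zigzag β`: one for `β = α`, and none unless `β ≤ α`
-- lexicographically.
theorem exists_N_basis :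
    ∃ b : Module.Basis Comp R (QSym R), ⇑b = fun α : Comp => N R α.2 := by
  classical
  obtain ⟨bL, hbL⟩ := exists_fundamentalBasis R
  let e := Equiv.ofBijective zigzagComp zigzagComp_bijective
  have hrepr : ∀ α β : Comp, (bL.reindex e.symm).repr (N R α.2) β =
      ({π ∈ (posetP α.2).jordanHolder |
        (⟨_, runComposition π⟩ : Comp) = zigzagComp β}.card : R) := by
    intro α β
    have h1 : N R α.2 = ∑ π ∈ (posetP α.2).jordanHolder, bL ⟨_, runComposition π⟩ := by
      rw [hbL]
      rfl
    rw [Module.Basis.repr_reindex_apply, Equiv.symm_symm, h1, map_sum, Finsupp.finsetSum_apply,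
      ← Finset.sum_boole]
    refine Finset.sum_congr rfl fun π _ => ?_
    rw [Module.Basis.repr_self, Finsupp.single_apply]
    rfl
  refine exists_basis_of_triangular (bL.reindex e.symm) _
    (fun β α => β.1 = α.1 ∧ β.2.blocks < α.2.blocks) ?_ ?_ ?_ ?_
  -- The lexicographic order on lists is not well-founded (`[2] > [1,2] > [1,1,2] > ⋯`); finiteness
  -- of the compositions of fixed weight replaces it.
  · refine ⟨?_⟩
    rintro ⟨n, α⟩
    have hwf : WellFounded fun α β : Composition n => α.blocks < β.blocks := by
      have : IsTrans (Composition n) fun α β => α.blocks < β.blocks := ⟨fun _ _ _ => lt_trans⟩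
      have : Std.Irrefl fun α β : Composition n => α.blocks < β.blocks := ⟨fun _ => lt_irrefl _⟩
      exact Finite.wellFounded_of_trans_of_irrefl _
    induction α using hwf.induction with
    | _ α ih =>
      refine Acc.intro _ ?_
      rintro ⟨k, β⟩ ⟨hk, hlt⟩
      dsimp only at hk
      subst hk
      exact ih β hlt
  · exact fun i j k h1 h2 => ⟨h1.1.trans h2.1, h1.2.trans h2.2⟩
  · intro α
    rw [hrepr, Finset.card_eq_one.2 ⟨zigzag α, ?_⟩, Nat.cast_one]
    ext π
    rw [Finset.mem_filter, Finset.mem_singleton]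
    constructor
    · rintro ⟨hπ, h⟩
      exact eq_zigzag hπ ((ascentWord_eq_of_runComposition_eq h).trans (ascentWord_zigzag α))
    · rintro rfl
      exact ⟨zigzag_mem α, rfl⟩
  · intro α β h
    rw [hrepr] at h
    obtain ⟨π, hπ⟩ : Finset.Nonempty
        {π ∈ (posetP α.2).jordanHolder | (⟨_, runComposition π⟩ : Comp) = zigzagComp β} := by
      by_contra hne
      rw [Finset.not_nonempty_iff_eq_empty.1 hne] at h
      simp at h
    rw [Finset.mem_filter] at hπ
    obtain ⟨h1, h2⟩ := blocks_le_of_runComposition_eq hπ.1 hπ.2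
    rcases h2.eq_or_lt with he | hlt
    · exact Or.inl ((Composition.sigma_eq_iff_blocks_eq).2 he)
    · exact Or.inr ⟨h1, hlt⟩

/-! ### The grading by rank -/

/-- The empty poset has one `P`-partition, the zero function, whose content is `0`. -/
theorem N_composition_zero (α : Composition 0) : N R α = 1 := by
  classical
  refine QSym_ext fun m => ?_
  have hb : α.blocks = [] := α.blocks_eq_nil.2 rfl
  have hl : (posetP α).labels = ∅ := by
    refine Finset.eq_empty_of_forall_notMem fun x hx => ?_
    unfold posetP altPoset at hx
    obtain ⟨B, hB, -⟩ := mem_labels_ordinalSum.1 hx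
    rw [hb] at hB
    simp [altBlocks] at hB
  have h : pPartitions (posetP α) m = if m = 0 then {0} else ∅ := by
    ext f
    rw [mem_pPartitions, hl]
    have hlt : ∀ x y, ¬ (posetP α).lt x y := fun x y hxy => by
      have := ((posetP α).mem_of_lt x y hxy).1
      simp [hl] at this
    simp only [Finset.subset_empty, Finsupp.support_eq_empty, Finset.sum_empty]
    split_ifs with hm
    · subst hm
      simp [hlt]
    · simp [Ne.symm hm]
  rw [N, coeff_F, h, OneMemClass.coe_one, MvPowerSeries.coeff_one]
  split_ifs <;> simp

theorem N_mem_rankPiece (α : Comp) : N R α.2 ∈ rankPiece R (rank α.2) :=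
  Submodule.subset_span ⟨α, rfl, rfl⟩

variable (R) in
theorem nonempty_gradedAlgebra_rankPiece : Nonempty (GradedAlgebra (rankPiece R)) := by
  classical
  obtain ⟨b, hb⟩ := exists_N_basis R
  have hmem : ∀ α : Comp, b α ∈ rankPiece R (rank α.2) := fun α => by
    rw [hb]
    exact N_mem_rankPiece α
  have hmon : SetLike.GradedMonoid (rankPiece R) :=
    { one_mem := by
        rw [← N_composition_zero (Composition.ones 0)]
        exact N_mem_rankPiece ⟨0, Composition.ones 0⟩
      mul_mem := by
        intro r s f g hf hg
        have hle : rankPiece R r * rankPiece R s ≤ rankPiece R (r + s) := by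
          unfold rankPiece
          rw [Submodule.span_mul_span, Submodule.span_le]
          rintro _ ⟨_, ⟨α, hα, rfl⟩, _, ⟨β, hβ, rfl⟩, rfl⟩
          simp only [N_mul_N]
          refine Submodule.sum_mem _ fun K hK => Submodule.subset_span ⟨_, ?_, rfl⟩
          rw [rank, toComp_blocks_of_mem_inducedPartitions hK, oddSum_of_mem_inducedPartitions hK,
            hα, hβ]
        exact hle (Submodule.mul_mem_mul hf hg) }
  -- The decomposition places each basis vector in the degree of its rank. That it inverts the
  -- summation map is checked on the basis on one side and on the spanning sets of the pieces on the
  -- other.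
  let f : QSym R →ₗ[R] DirectSum ℕ fun r => rankPiece R r :=
    b.constr R fun α => DirectSum.lof R ℕ (fun r => rankPiece R r) (rank α.2) ⟨b α, hmem α⟩
  have hf : ∀ α, f (b α) =
      DirectSum.lof R ℕ (fun r => rankPiece R r) (rank α.2) ⟨b α, hmem α⟩ :=
    fun α => b.constr_basis R _ α
  refine ⟨{ hmon, DirectSum.Decomposition.ofLinearMap (rankPiece R) f ?_ ?_ with }⟩
  · refine b.ext fun α => ?_
    rw [LinearMap.comp_apply, hf, DirectSum.coeLinearMap_lof]
    rfl
  · refine DirectSum.linearMap_ext R fun r => LinearMap.ext ?_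
    rintro ⟨x, hx⟩
    simp only [LinearMap.comp_apply, DirectSum.coeLinearMap_lof, LinearMap.id_apply]
    induction hx using Submodule.span_induction with
    | mem x h =>
      obtain ⟨α, rfl, rfl⟩ := h
      have h1 := hf α
      simp only [hb] at h1
      exact h1
    | zero => exact (map_zero f).trans (map_zero _).symm
    | add x y hx hy h1 h2 =>
      rw [map_add, h1, h2, ← map_add]
      rfl
    | smul a x hx h1 =>
      rw [map_smul, h1, ← map_smul]
      rfl

end QSymN

/-! ### Assembly of the four claims -/

theorem theorem4p5 (R : Type*) [CommRing R] :
    -- the graded pieces `rankPiece R r` make `QSym R` a graded algebra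
    Nonempty (GradedAlgebra (QSymN.rankPiece R)) ∧
    -- the `N_α` form a basis, with the stated structure constants
    (∃ b : Module.Basis QSymN.Comp R (QSymN.QSym R),
      (∀ α : QSymN.Comp, b α = QSymN.N R α.2) ∧
      ∀ α β ν : QSymN.Comp,
        b.repr (QSymN.N R α.2 * QSymN.N R β.2) ν =
          (QSymN.structureCount α.2 β.2 ν.2 : R)) ∧
    -- the structure constants count alternating ordered partitions
    (∀ α β : QSymN.Comp,
      ∀ K ∈ QSymN.inducedPartitions (QSymN.posetQ α.2 β.2) (QSymN.partitionT α.2 β.2),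
        QSymN.IsAlternating K) ∧
    -- and vanish unless the ranks add up
    (∀ α β ν : QSymN.Comp, QSymN.structureCount α.2 β.2 ν.2 ≠ 0 →
      QSymN.rank ν.2 = QSymN.rank α.2 + QSymN.rank β.2) := by
  classical
  refine ⟨QSymN.nonempty_gradedAlgebra_rankPiece R, ?_,
    fun α β K hK => QSymN.isAlternating_of_mem_inducedPartitions hK, fun α β ν h => ?_⟩
  · obtain ⟨b, hb⟩ := QSymN.exists_N_basis R
    refine ⟨b, fun α => by rw [hb], fun α β ν => ?_⟩
    have h : ∀ α : QSymN.Comp, QSymN.N R α.2 = b α := fun α => by rw [hb]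
    rw [QSymN.N_mul_N]
    simp only [h, map_sum, Finsupp.finsetSum_apply, Module.Basis.repr_self, Finsupp.single_apply]
    rw [Finset.sum_boole, QSymN.structureCount]
    congr 2
    -- Collecting equal terms of the product formula, the condition that `toComp` of the type of `K`
    -- is `ν` becomes equality of block lists, since all sets of `K` are nonempty.
    refine Finset.filter_congr fun K hK => ?_
    rw [Composition.sigma_eq_iff_blocks_eq, QSymN.toComp_blocks_of_mem_inducedPartitions hK]
  · obtain ⟨K, hK⟩ := Finset.card_ne_zero.1 h
    obtain ⟨hK, hν⟩ := Finset.mem_filter.1 hK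
    rw [QSymN.rank, ← hν, QSymN.oddSum_of_mem_inducedPartitions hK]
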